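/- Let $R$ be a commutative noetherian ring, let $M$ be a finitely generated $R$-module, and put $S=\mathrm{End}_R(M)$. Notation. $\mathrm{add}(M)$ (resp. $\mathrm{Add}(M)$) is the class of modules isomorphic to a direct summand of a finite (resp. arbitrary) direct sum of copies of $M$. $V(M)$ is the monoid, under direct sum, of isomorphism classes of modules in $\mathrm{add}(M)$, and $V^*(M)\supseteq V(M)$ is the monoid of isomorphism classes of countably generated modules in $\mathrm{Add}(M)$. The same notation is used for right modules over other rings; $V(S/I)$ is the monoid of isomorphism classes of finitely generated projective right $S/I$-modules, and $V^*(S)$ that of countably generated projective right $S$-modules. The trace of a projective right $S$-module $P$ is the ideal $\mathrm{Tr}_S(P)=\sum_{f\in \mathrm{Hom}_S(P,S)}f(P)$, and $\mathcal T(S)$ is the set of traces of countably generated projective right $S$-modules. A countably generated projective right $S$-module $P$ is $I$-big, for an ideal $I$, if every countably generated projective right $S$-module $Q$ with $QI=Q$ is a homomorphic image of $P$. For $I\in\mathcal T(S)$, the map $\iota_I\colon V(S/I)\to V^*(S)$ sends $[P']$ to $[P]$, where $P$ is a countably generated projective $I$-big right $S$-module with $P/PI\cong P'$, and $\alpha_I\colon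 V(S/I)\to V^*(M)$ is $\iota_I$ followed by the inverse of the isomorphism $V^*(M)\to V^*(S)$, $[X]\mapsto[\mathrm{Hom}_R(M,X)]$. Finally, $B(M)=\bigcup_{0\ne I\in\mathcal T(S)}\alpha_I(V(S/I))$. Then: 1. $V^*(M)=V(M)\sqcup B(M)$, that is, $V^*(M)=V(M)\cup B(M)$ and $V(M)\cap B(M)=\emptyset$. 2. For every countably generated module $X$ in $\mathrm{Add}(M)$ there are exactly one trace ideal $I\in\mathcal T(S)$ and exactly one class $[P']\in V(S/I)$ such that $[X]=\alpha_I([P'])$; and for every $I\in\mathcal T(S)$ and $[P']\in V(S/I)$ there is exactly one class $\alpha_I([P'])$ in $V^*(M)$ as described (in particular, $\alpha_I$ is well defined). Thus $X$ is determined up to isomorphism by the pair $(I,[P'])$, and every such pair occurs. -/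

import Mathlib

universe u v

/-! ### Isomorphism classes of modules

Conventions. Over a noncommutative ring `A`, "module" means left module, as in Mathlib. Right modules
over a ring `S` are modules over the opposite ring of `S`; the two rings have the same two-sided ideals,
and the opposite of `S / I` is the quotient of the opposite of `S` by `I`. -/

/-- `N` is isomorphic to a direct summand of `L`: there are maps `N → L → N` composing to the identity. -/
def IsSummand (A : Type v) [Ring A] (N L : Type u) [AddCommGroup N] [Module A N]
    [AddCommGroup L] [Module A L] : Prop :=
  ∃ (i : N →ₗ[A] L) (p : L →ₗ[A] N), p ∘ₗ i = LinearMap.id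

/-- The module `N` has a countable generating set. -/
def IsCountablyGen (A : Type v) [Ring A] (N : Type u) [AddCommGroup N] [Module A N] : Prop :=
  ∃ s : Set N, s.Countable ∧ Submodule.span A s = ⊤

/-- `N` belongs to `add(M)`: it is isomorphic to a direct summand of a finite direct sum of copies
of `M`. -/
def MemFinAdd (A : Type v) [Ring A] (M N : Type u) [AddCommGroup M] [Module A M]
    [AddCommGroup N] [Module A N] : Prop :=
  ∃ n : ℕ, IsSummand A N (Fin n → M)

/-- `N` belongs to `Add(M)`: it is isomorphic to a direct summand of an arbitrary direct sum of copies
of `M`. -/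
def MemAdd (A : Type v) [Ring A] (M N : Type u) [AddCommGroup M] [Module A M]
    [AddCommGroup N] [Module A N] : Prop :=
  ∃ ι : Type u, IsSummand A N (ι →₀ M)

theorem IsSummand.prod {A : Type v} [Ring A] {N₁ N₂ L₁ L₂ L : Type u}
    [AddCommGroup N₁] [Module A N₁] [AddCommGroup N₂] [Module A N₂]
    [AddCommGroup L₁] [Module A L₁] [AddCommGroup L₂] [Module A L₂] [AddCommGroup L] [Module A L]
    (h₁ : IsSummand A N₁ L₁) (h₂ : IsSummand A N₂ L₂) (e : (L₁ × L₂) ≃ₗ[A] L) :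
    IsSummand A (N₁ × N₂) L := by
  obtain ⟨i₁, p₁, h₁⟩ := h₁
  obtain ⟨i₂, p₂, h₂⟩ := h₂
  refine ⟨e.toLinearMap ∘ₗ i₁.prodMap i₂, p₁.prodMap p₂ ∘ₗ e.symm.toLinearMap, ?_⟩
  have h₁' : ∀ x, p₁ (i₁ x) = x := fun x => LinearMap.congr_fun h₁ x
  have h₂' : ∀ x, p₂ (i₂ x) = x := fun x => LinearMap.congr_fun h₂ x
  refine LinearMap.ext fun x => ?_
  simp [h₁', h₂']

theorem MemFinAdd.prod {A : Type v} [Ring A] {M N₁ N₂ : Type u} [AddCommGroup M] [Module A M]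
    [AddCommGroup N₁] [Module A N₁] [AddCommGroup N₂] [Module A N₂]
    (h₁ : MemFinAdd A M N₁) (h₂ : MemFinAdd A M N₂) : MemFinAdd A M (N₁ × N₂) := by
  obtain ⟨m, h₁⟩ := h₁
  obtain ⟨n, h₂⟩ := h₂
  exact ⟨m + n, h₁.prod h₂ ((LinearEquiv.sumArrowLequivProdArrow (Fin m) (Fin n) A M).symm.trans
    (LinearEquiv.funCongrLeft A M finSumFinEquiv.symm))⟩

theorem MemAdd.prod {A : Type v} [Ring A] {M N₁ N₂ : Type u} [AddCommGroup M] [Module A M]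
    [AddCommGroup N₁] [Module A N₁] [AddCommGroup N₂] [Module A N₂]
    (h₁ : MemAdd A M N₁) (h₂ : MemAdd A M N₂) : MemAdd A M (N₁ × N₂) := by
  obtain ⟨α, h₁⟩ := h₁
  obtain ⟨β, h₂⟩ := h₂
  exact ⟨α ⊕ β, h₁.prod h₂ (Finsupp.sumFinsuppLEquivProdFinsupp A).symm⟩

theorem IsCountablyGen.prod {A : Type v} [Ring A] {N₁ N₂ : Type u}
    [AddCommGroup N₁] [Module A N₁] [AddCommGroup N₂] [Module A N₂]
    (h₁ : IsCountablyGen A N₁) (h₂ : IsCountablyGen A N₂) : IsCountablyGen A (N₁ × N₂) := by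
  obtain ⟨s, hs, h₁⟩ := h₁
  obtain ⟨t, ht, h₂⟩ := h₂
  refine ⟨LinearMap.inl A N₁ N₂ '' s ∪ LinearMap.inr A N₁ N₂ '' t,
    (hs.image _).union (ht.image _), ?_⟩
  rw [LinearMap.span_inl_union_inr, h₁, h₂, Submodule.prod_top]

/-- The relation of being isomorphic, on the `A`-modules of the universe `u`. -/
instance isoSetoid (A : Type v) [Ring A] : Setoid (ModuleCat.{u} A) where
  r X Y := Nonempty (X ≃ₗ[A] Y)
  iseqv := ⟨fun _ => ⟨LinearEquiv.refl _ _⟩, fun ⟨e⟩ => ⟨e.symm⟩, fun ⟨e⟩ ⟨f⟩ => ⟨e.trans f⟩⟩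

/-- Isomorphism classes of `A`-modules. -/
def IsoClass (A : Type v) [Ring A] : Type (max v (u + 1)) :=
  Quotient (isoSetoid.{u, v} A)

/-- The isomorphism class `[N]` of the module `N`. -/
def isoClass (A : Type v) [Ring A] (N : Type u) [AddCommGroup N] [Module A N] :
    IsoClass.{u, v} A :=
  Quotient.mk (isoSetoid A) (ModuleCat.of A N)

theorem isoClass_eq_iff {A : Type v} [Ring A] {N L : Type u} [AddCommGroup N] [Module A N]
    [AddCommGroup L] [Module A L] : isoClass A N = isoClass A L ↔ Nonempty (N ≃ₗ[A] L) :=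
  Quotient.eq (r := isoSetoid A)

instance (A : Type v) [Ring A] : Zero (IsoClass.{u, v} A) := ⟨isoClass A PUnit⟩

instance (A : Type v) [Ring A] : Add (IsoClass.{u, v} A) where
  add := Quotient.map₂ (fun X Y => ModuleCat.of A (X × Y))
    fun _ _ ⟨e⟩ _ _ ⟨f⟩ => ⟨LinearEquiv.prodCongr e f⟩

/-- The isomorphism classes of modules form a commutative monoid, with `[N] + [L] = [N ⊕ L]`. -/
instance (A : Type v) [Ring A] : AddCommMonoid (IsoClass.{u, v} A) where
  add_assoc := by
    rintro ⟨X⟩ ⟨Y⟩ ⟨Z⟩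
    exact Quotient.sound ⟨LinearEquiv.prodAssoc A X Y Z⟩
  zero_add := by
    rintro ⟨X⟩
    exact Quotient.sound ⟨LinearEquiv.uniqueProd⟩
  add_zero := by
    rintro ⟨X⟩
    exact Quotient.sound ⟨LinearEquiv.prodUnique⟩
  add_comm := by
    rintro ⟨X⟩ ⟨Y⟩
    exact Quotient.sound ⟨LinearEquiv.prodComm A X Y⟩
  nsmul := nsmulRec

theorem isoClass_add (A : Type v) [Ring A] (N L : Type u) [AddCommGroup N] [Module A N]
    [AddCommGroup L] [Module A L] : isoClass A N + isoClass A L = isoClass A (N × L) := rfl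

/-- The monoid `V(M)` of isomorphism classes of modules in `add(M)`. -/
def VMonoid (A : Type v) [Ring A] (M : Type u) [AddCommGroup M] [Module A M] :
    AddSubmonoid (IsoClass.{u, v} A) where
  carrier := {x | ∃ N : ModuleCat.{u} A, isoClass A N = x ∧ MemFinAdd A M N}
  zero_mem' := ⟨ModuleCat.of A PUnit, rfl, 0, 0, 0, LinearMap.ext fun _ => rfl⟩
  add_mem' := by
    rintro _ _ ⟨N, rfl, hN⟩ ⟨L, rfl, hL⟩
    exact ⟨ModuleCat.of A (N × L), rfl, hN.prod hL⟩

/-- The monoid `V*(M)` of isomorphism classes of countably generated modules in `Add(M)`. -/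
def VStar (A : Type v) [Ring A] (M : Type u) [AddCommGroup M] [Module A M] :
    AddSubmonoid (IsoClass.{u, v} A) where
  carrier := {x | ∃ N : ModuleCat.{u} A, isoClass A N = x ∧ IsCountablyGen A N ∧ MemAdd A M N}
  zero_mem' := ⟨ModuleCat.of A PUnit, rfl, ⟨∅, Set.countable_empty, Subsingleton.elim _ _⟩,
    PEmpty, 0, 0, LinearMap.ext fun _ => rfl⟩
  add_mem' := by
    rintro _ _ ⟨N, rfl, hN, hN'⟩ ⟨L, rfl, hL, hL'⟩
    exact ⟨ModuleCat.of A (N × L), rfl, hN.prod hL, hN'.prod hL'⟩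

/-! ### Trace ideals and relatively big projective modules -/

section

variable (A : Type u) [Ring A]

/-- The trace of a module `P`: the sum of the images of all homomorphisms `P → A`. -/
def traceOf (P : Type u) [AddCommGroup P] [Module A P] : Ideal A :=
  ⨆ f : P →ₗ[A] A, LinearMap.range f

instance (P : Type u) [AddCommGroup P] [Module A P] : (traceOf A P).IsTwoSided where
  mul_mem_of_left {a} b ha := by
    have h : traceOf A P ≤ Submodule.comap (LinearMap.toSpanSingleton A A b) (traceOf A P) := by
      refine iSup_le fun f => ?_
      rintro _ ⟨x, rfl⟩
      exact Submodule.mem_iSup_of_mem (LinearMap.toSpanSingleton A A b ∘ₗ f) ⟨x, rfl⟩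
    exact h ha

/-- The set `𝒯` of trace ideals of countably generated projective modules. -/
def TraceIdeals : Type u :=
  {I : Ideal A // ∃ P : ModuleCat.{u} A,
    IsCountablyGen A P ∧ Module.Projective A P ∧ traceOf A P = I}

variable {A}

/-- A trace ideal, as an ideal. -/
def TraceIdeals.ideal (I : TraceIdeals A) : Ideal A := I.1

instance (I : TraceIdeals A) : I.ideal.IsTwoSided := by
  obtain ⟨_, P, _, _, rfl⟩ := I
  exact inferInstanceAs (traceOf A P).IsTwoSided

/-- `P` is big with respect to `I` (`I`-big): every countably generated projective module `Q` with
`I Q = Q` is a homomorphic image of `P`. -/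
def IsBig (I : Ideal A) (P : Type u) [AddCommGroup P] [Module A P] : Prop :=
  ∀ Q : ModuleCat.{u} A, IsCountablyGen A Q → Module.Projective A Q →
    I • (⊤ : Submodule A Q) = ⊤ → ∃ f : P →ₗ[A] Q, Function.Surjective f

/-- The graph of the embedding `ι_I : V(A/I) → V*(A)`: `IotaRel I q p` says that `p = [P]` for a
countably generated projective `I`-big module `P` such that `q = [P/IP]`. -/
def IotaRel (I : TraceIdeals A) (q : IsoClass.{u, u} (A ⧸ I.ideal)) (p : IsoClass.{u, u} A) : Prop :=
  ∃ P : ModuleCat.{u} A, isoClass A P = p ∧ IsCountablyGen A P ∧ Module.Projective A P ∧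
    IsBig I.ideal P ∧
    isoClass (A ⧸ I.ideal) (P ⧸ I.ideal • (⊤ : Submodule A P)) = q

end

/-! ### Passing from `M` to its endomorphism ring -/

section

variable (R : Type v) [Ring R] (M : Type u) [AddCommGroup M] [Module R M]

/-- The opposite ring of `S = End_R(M)`, whose (left) modules are the right `S`-modules. For every
`R`-module `X`, the right `S`-module structure of `Hom_R(M, X)` is precomposition. -/
abbrev EndOp : Type u := (Module.End R M)ᵈᵐᵃ

/-- The map `[X] ↦ [Hom_R(M, X)]` from isomorphism classes of `R`-modules to isomorphism classes of
right modules over `S = End_R(M)`. -/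
def homClass : IsoClass.{u, v} R → IsoClass.{u, u} (EndOp R M) :=
  Quotient.map (fun X => ModuleCat.of (EndOp R M) (M →ₗ[R] X)) fun _ _ ⟨e⟩ =>
    ⟨{ toFun := fun f => e.toLinearMap ∘ₗ f
       invFun := fun f => e.symm.toLinearMap ∘ₗ f
       map_add' := fun f g => LinearMap.comp_add f g e.toLinearMap
       map_smul' := fun _ _ => rfl
       left_inv := fun f => LinearMap.ext fun x => e.symm_apply_apply (f x)
       right_inv := fun f => LinearMap.ext fun x => e.apply_symm_apply (f x) }⟩

variable {R M}

/-- The graph of `α_I : V(S/I) → V*(M)`, the composition of `ι_I : V(S/I) → V*(S)` with the isomorphism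
`V*(S) ≅ V*(M)` inverse to `[X] ↦ [Hom_R(M, X)]`. -/
def AlphaRel (I : TraceIdeals (EndOp R M)) (q : IsoClass.{u, u} (EndOp R M ⧸ I.ideal))
    (x : IsoClass.{u, v} R) : Prop :=
  x ∈ VStar R M ∧ IotaRel I q (homClass R M x)

variable (R M)

/-- `V(S/I)` for `S = End_R(M)`: isomorphism classes of finitely generated projective right
`S/I`-modules. -/
abbrev VQuot (I : TraceIdeals (EndOp R M)) : AddSubmonoid (IsoClass.{u, u} (EndOp R M ⧸ I.ideal)) :=
  VMonoid (EndOp R M ⧸ I.ideal) (EndOp R M ⧸ I.ideal)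

/-- `B(M)`: the union of the sets `α_I(V(S/I))` over the nonzero trace ideals `I` of `S`. -/
def BSet : Set (IsoClass.{u, v} R) :=
  {x | ∃ I : TraceIdeals (EndOp R M), I.ideal ≠ ⊥ ∧ ∃ q ∈ VQuot R M I, AlphaRel I q x}

end

/-! Since `M` is finitely generated, `Hom_R(M, -)` is an equivalence from `Add(M)` to the
projective right `S`-modules, so the theorem is about countably generated projective modules `P`
over a ring `A` that is finite as an algebra over a commutative noetherian ring.

*The ideal of `P`.* Let `P` be exhausted by finitely generated submodules `X₀ ≤ X₁ ≤ ⋯`. If `Xₙ₊₁`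
contains the dual basis elements occurring in `Xₙ`, the traces `Tₙ` of `P / Xₙ` satisfy
`Tₙ₊₁ ≤ Tₙ Tₙ₊₁`. Such a chain of ideals in `A` is eventually constant. By noetherian induction
this is a question about a prime ring `B` with centre `C`; its ring of fractions is central
simple, which yields a nonzero `s` in `C` with `s T ≤ (T ∩ C) B` for all ideals `T`. From
`0 ≠ L ≤ T L` one gets `s L ≤ (T ∩ C) L`, and Cayley-Hamilton puts a power of `s` into `T`. The
eventual value `I` of the `Tₙ` is idempotent, `P / IP` is finitely generated, and `P` is `I`-big:
every finitely generated piece of `P` leaves enough homomorphisms `P → A` vanishing on it to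
extend a map to a module `Q = IQ` step by step to a surjection. Conversely, if `P` is `I`-big and
`P / JP` is finitely generated, then `I ≤ J`, so `I` is determined by `P`.

*Uniqueness.* Let `I` be the trace of `W`. By the Eilenberg swindle an `I`-big module `P` absorbs
every projective `K = IK`. An isomorphism `P / IP ≃ Q / IQ` lifts to a surjection `P ⊕ W^(ℕ) → Q`
whose kernel `K` satisfies `K = IK`, so that `P ≃ P ⊕ W^(ℕ) ≃ K ⊕ Q ≃ Q`.

*Existence.* Let `I = I²`, and lift a projection of `(A / I)ⁿ` onto a given module to an
endomorphism `ε` of `Y = Aⁿ`. Both `ε - ε²` and right multiplication by a generator of `I` factor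
through products of two right multiplications `X j` by generators. Hence the endomorphism of
`Y^(words)` which applies `ε` at the empty word and moves `y` at `w` to `X j y` at `jw` has a left
inverse on its image, so its telescope is projective; modulo `I` this telescope is the image of
`ε`. -/

section Exhaustion

variable {A P Q : Type*} [Ring A] [AddCommGroup P] [Module A P] [AddCommGroup Q] [Module A Q]

theorem exists_linearMap_forall_eqOn {X : ℕ → Submodule A P} (hX : Monotone X)
    (hXtop : ∀ p, ∃ n, p ∈ X n) {f : ℕ → P →ₗ[A] Q}
    (hf : ∀ n, Set.EqOn (f (n + 1)) (f n) (X n)) :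
    ∃ g : P →ₗ[A] Q, ∀ n, Set.EqOn g (f n) (X n) := by
  choose N hN using hXtop
  have hmono : ∀ {m n}, m ≤ n → Set.EqOn (f n) (f m) (X m) := fun {m n} hmn p hp => by
    induction n, hmn using Nat.le_induction with
    | base => rfl
    | succ n hmn ih => exact (hf n (hX hmn hp)).trans ih
  have hval : ∀ n, ∀ p ∈ X n, f (N p) p = f n p := fun n p hp =>
    (le_total (N p) n).elim (fun h => (hmono h (hN p)).symm) fun h => hmono h hp
  have hadd : ∀ p q, f (N (p + q)) (p + q) = f (N p) p + f (N q) q := fun p q => by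
    have hp := hX (le_max_left (N p) (N q)) (hN p)
    have hq := hX (le_max_right (N p) (N q)) (hN q)
    rw [hval _ p hp, hval _ q hq, hval _ _ (add_mem hp hq), map_add]
  have hsmul : ∀ (a : A) p, f (N (a • p)) (a • p) = a • f (N p) p := fun a p => by
    rw [hval _ _ (Submodule.smul_mem _ a (hN p)), map_smul]
  exact ⟨{ toFun := fun p => f (N p) p, map_add' := hadd, map_smul' := hsmul }, hval⟩

theorem exists_fg_map_eq {f : P →ₗ[A] Q} {N : Submodule A Q} (hN : N.FG)
    (hle : N ≤ LinearMap.range f) : ∃ X : Submodule A P, X.FG ∧ X.map f = N := by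
  classical
  obtain ⟨s, rfl⟩ := hN
  have hs : (s : Set Q) ⊆ f '' Set.univ := by
    rw [Set.image_univ, ← LinearMap.coe_range]
    exact Submodule.subset_span.trans hle
  obtain ⟨t, -, rfl⟩ := Finset.subset_set_image_iff.1 hs
  exact ⟨Submodule.span A t, ⟨t, rfl⟩, by rw [Submodule.map_span, Finset.coe_image]⟩

theorem fg_of_le_of_fg [IsNoetherianRing A] {X Y : Submodule A P} (hle : X ≤ Y) (hY : Y.FG) :
    X.FG :=
  have := isNoetherian_of_fg_of_noetherian Y hY
  have := isNoetherian_of_injective _ (Submodule.inclusion_injective hle)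
  Submodule.FG.of_finite

end Exhaustion

section CountablyGenerated

variable {A : Type v} [Ring A] {P Q : Type u} [AddCommGroup P] [Module A P]
  [AddCommGroup Q] [Module A Q]

namespace IsCountablyGen

theorem of_surjective (h : IsCountablyGen A P) (f : P →ₗ[A] Q) (hf : Function.Surjective f) :
    IsCountablyGen A Q := by
  obtain ⟨s, hs, h⟩ := h
  refine ⟨f '' s, hs.image _, ?_⟩
  rw [← Submodule.map_span, h, Submodule.map_top, LinearMap.range_eq_top.2 hf]

theorem of_finite [h : Module.Finite A P] : IsCountablyGen A P :=
  let ⟨s, hs⟩ := h.fg_top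
  ⟨s, s.countable_toSet, hs⟩

theorem of_iSup_fg {X : ℕ → Submodule A P} (hX : ∀ n, (X n).FG) (h : ⨆ n, X n = ⊤) :
    IsCountablyGen A P := by
  choose s hs using hX
  refine ⟨⋃ n, (s n : Set P), Set.countable_iUnion fun n => (s n).countable_toSet, ?_⟩
  simp only [Submodule.span_iUnion, hs, h]

theorem exists_seq (h : IsCountablyGen A P) :
    ∃ x : ℕ → P, Submodule.span A (Set.range x) = ⊤ := by
  obtain ⟨s, hs, h⟩ := h
  obtain ⟨x, hx⟩ := (hs.insert 0).exists_eq_range ⟨0, Set.mem_insert _ _⟩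
  exact ⟨x, by rw [← hx, Submodule.span_insert_zero, h]⟩

theorem finsupp (h : IsCountablyGen A P) (ι : Type*) [Countable ι] :
    IsCountablyGen A (ι →₀ P) := by
  obtain ⟨s, hs, h⟩ := h
  refine ⟨⋃ i, Finsupp.lsingle (R := A) i '' s, Set.countable_iUnion fun i => hs.image _, ?_⟩
  simp only [Submodule.span_iUnion, ← Submodule.map_span, h, Submodule.map_top]
  exact Finsupp.iSup_lsingle_range

theorem exists_monotone_fg (h : IsCountablyGen A P) :
    ∃ X : ℕ → Submodule A P, Monotone X ∧ (∀ n, (X n).FG) ∧ ∀ p, ∃ n, p ∈ X n := by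
  obtain ⟨x, hx⟩ := h.exists_seq
  have hmono : Monotone fun n => Submodule.span A (x '' Set.Iio n) := fun _ _ hmn =>
    Submodule.span_mono (Set.image_mono (Set.Iio_subset_Iio hmn))
  refine ⟨_, hmono, fun n => Submodule.fg_span ((Set.finite_Iio n).image x), fun p => ?_⟩
  rw [← Submodule.mem_iSup_of_directed _ hmono.directed_le, ← Submodule.span_iUnion,
    ← Set.image_iUnion, Set.iUnion_Iio, Set.image_univ, hx]
  trivial

theorem submodule [IsNoetherianRing A] (h : IsCountablyGen A P) (N : Submodule A P) :
    IsCountablyGen A N := by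
  obtain ⟨X, -, hX, hXtop⟩ := h.exists_monotone_fg
  refine of_iSup_fg (X := fun n => (X n).comap N.subtype) (fun n => ?_) (eq_top_iff.2 fun x _ => ?_)
  · refine Submodule.fg_of_fg_map_injective N.subtype N.injective_subtype ?_
    exact fg_of_le_of_fg (Submodule.map_comap_le _ _) (hX n)
  · obtain ⟨n, hn⟩ := hXtop x
    exact Submodule.mem_iSup_of_mem n hn

end IsCountablyGen

end CountablyGenerated

section Summands

variable {A : Type v} [Ring A] {N L K : Type u} [AddCommGroup N] [Module A N]
  [AddCommGroup L] [Module A L] [AddCommGroup K] [Module A K]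

namespace IsSummand

theorem of_equiv (e : N ≃ₗ[A] L) : IsSummand A N L :=
  ⟨e.toLinearMap, e.symm.toLinearMap, LinearMap.ext e.symm_apply_apply⟩

theorem trans (h : IsSummand A N L) (h' : IsSummand A L K) : IsSummand A N K := by
  obtain ⟨i, p, h⟩ := h
  obtain ⟨i', p', h'⟩ := h'
  refine ⟨i' ∘ₗ i, p ∘ₗ p', ?_⟩
  rw [LinearMap.comp_assoc, ← LinearMap.comp_assoc i, h', LinearMap.id_comp, h]

theorem exists_surjective (h : IsSummand A N L) : ∃ p : L →ₗ[A] N, Function.Surjective p := by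
  obtain ⟨i, p, h⟩ := h
  exact ⟨p, Function.LeftInverse.surjective (LinearMap.congr_fun h)⟩

theorem isCountablyGen (h : IsSummand A N L) (hL : IsCountablyGen A L) : IsCountablyGen A N := by
  obtain ⟨p, hp⟩ := h.exists_surjective
  exact hL.of_surjective p hp

theorem finite (h : IsSummand A N L) [Module.Finite A L] : Module.Finite A N := by
  obtain ⟨p, hp⟩ := h.exists_surjective
  exact Module.Finite.of_surjective p hp

theorem of_surjective [Module.Projective A N] {p : L →ₗ[A] N}
    (hp : Function.Surjective p) : IsSummand A N L := by
  obtain ⟨i, hi⟩ := Module.projective_lifting_property p LinearMap.id hp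
  exact ⟨i, p, hi⟩

end IsSummand

end Summands

section SmulTop

variable {A P Q : Type*} [Ring A] [AddCommGroup P] [Module A P] [AddCommGroup Q] [Module A Q]
  {I : Ideal A}

theorem map_mem_smul_top (f : P →ₗ[A] Q) {x : P} (hx : x ∈ I • (⊤ : Submodule A P)) :
    f x ∈ I • (⊤ : Submodule A Q) := by
  have hfx := Submodule.mem_map_of_mem (f := f) hx
  rw [Submodule.map_smul''] at hfx
  exact Submodule.smul_mono le_rfl le_top hfx

theorem smul_top_finsupp {ι : Type*} (h : I • (⊤ : Submodule A P) = ⊤) :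
    I • (⊤ : Submodule A (ι →₀ P)) = ⊤ := by
  have hle : ⨆ i, LinearMap.range (Finsupp.lsingle (R := A) (M := P) i) ≤
      I • (⊤ : Submodule A (ι →₀ P)) := iSup_le fun i => by
    rintro _ ⟨p, rfl⟩
    exact map_mem_smul_top _ (h.ge Submodule.mem_top)
  rwa [Finsupp.iSup_lsingle_range, top_le_iff] at hle

theorem mem_smul_top_prod {x : P × Q} (h₁ : x.1 ∈ I • (⊤ : Submodule A P))
    (h₂ : x.2 ∈ I • (⊤ : Submodule A Q)) : x ∈ I • (⊤ : Submodule A (P × Q)) := by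
  have hx : x = LinearMap.inl A P Q x.1 + LinearMap.inr A P Q x.2 := by simp
  rw [hx]
  exact add_mem (map_mem_smul_top _ h₁) (map_mem_smul_top _ h₂)

end SmulTop

section Trace

variable {A : Type u} [Ring A] {P Q : Type u} [AddCommGroup P] [Module A P]
  [AddCommGroup Q] [Module A Q]

theorem apply_mem_traceOf (f : P →ₗ[A] A) (x : P) : f x ∈ traceOf A P :=
  Submodule.mem_iSup_of_mem f ⟨x, rfl⟩

theorem traceOf_le_iff {J : Ideal A} :
    traceOf A P ≤ J ↔ ∀ (f : P →ₗ[A] A) (x : P), f x ∈ J := by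
  refine ⟨fun h f x => h (apply_mem_traceOf f x), fun h => iSup_le fun f => ?_⟩
  rintro _ ⟨x, rfl⟩
  exact h f x

theorem traceOf_le_of_surjective (g : P →ₗ[A] Q) (hg : Function.Surjective g) :
    traceOf A Q ≤ traceOf A P :=
  traceOf_le_iff.2 fun f => hg.forall.2 fun x => apply_mem_traceOf (f ∘ₗ g) x

theorem traceOf_le_of_smul_top {I : Ideal A} [I.IsTwoSided]
    (h : I • (⊤ : Submodule A P) = ⊤) : traceOf A P ≤ I :=
  traceOf_le_iff.2 fun f x => by
    have hfx : f x ∈ I * ⊤ := map_mem_smul_top f (h.ge Submodule.mem_top)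
    exact Ideal.mul_le_left hfx

theorem traceOf_smul_top [hP : Module.Projective A P] :
    traceOf A P • (⊤ : Submodule A P) = ⊤ := by
  refine eq_top_iff.2 fun x _ => ?_
  obtain ⟨s, hs⟩ := Module.projective_def'.1 hP
  have hx : Finsupp.linearCombination A id (s x) = x := LinearMap.congr_fun hs x
  rw [← hx, Finsupp.linearCombination_apply]
  exact Submodule.sum_mem _ fun p _ => Submodule.smul_mem_smul
    (apply_mem_traceOf (Finsupp.lapply p ∘ₗ s) x) trivial

theorem traceOf_mul_self [Module.Projective A P] :
    traceOf A P * traceOf A P = traceOf A P := by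
  refine le_antisymm Ideal.mul_le_right (traceOf_le_iff.2 fun f x => ?_)
  have hx : x ∈ traceOf A P • (⊤ : Submodule A P) := traceOf_smul_top.ge Submodule.mem_top
  refine Submodule.smul_induction_on hx (fun a ha y _ => ?_) fun x y hx hy => ?_
  · rw [map_smul]
    exact Ideal.mul_mem_mul ha (apply_mem_traceOf f y)
  · rw [map_add]
    exact add_mem hx hy

theorem traceOf_quotient_le_iff {X : Submodule A P} {J : Ideal A} :
    traceOf A (P ⧸ X) ≤ J ↔ ∀ f : P →ₗ[A] A, X ≤ LinearMap.ker f → ∀ x, f x ∈ J := by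
  refine traceOf_le_iff.trans ⟨fun h f hf x => h (X.liftQ f hf) (X.mkQ x), fun h f => ?_⟩
  refine X.mkQ_surjective.forall.2 (h (f ∘ₗ X.mkQ) ?_)
  exact X.ker_mkQ.ge.trans (LinearMap.ker_le_ker_comp _ _)

theorem traceOf_quotient_antitone {X Y : Submodule A P} (h : X ≤ Y) :
    traceOf A (P ⧸ Y) ≤ traceOf A (P ⧸ X) :=
  traceOf_le_of_surjective (Submodule.factor h) (Submodule.factor_surjective h)

end Trace

section Stages

variable {A : Type u} [Ring A] {P Q : Type u} [AddCommGroup P] [Module A P]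
  [AddCommGroup Q] [Module A Q]

/-- A finite stage in the construction of a surjection `P → Q`: a linear map `map` together with a
finitely generated submodule `dom` which `map` sends onto its whole range. Later stages may change
`map` outside `dom` only. -/
structure FiniteStage (A : Type u) [Ring A] (P Q : Type u) [AddCommGroup P] [Module A P]
    [AddCommGroup Q] [Module A Q] where
  map : P →ₗ[A] Q
  dom : Submodule A P
  fg_dom : dom.FG
  map_dom : dom.map map = LinearMap.range map

namespace FiniteStage

instance : Preorder (FiniteStage A P Q) where
  le s t := s.dom ≤ t.dom ∧ Set.EqOn t.map s.map s.dom
  le_refl _ := ⟨le_rfl, fun _ _ => rfl⟩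
  le_trans _ _ _ hst htu := ⟨hst.1.trans htu.1, (htu.2.mono hst.1).trans hst.2⟩

instance : Inhabited (FiniteStage A P Q) :=
  ⟨⟨0, ⊥, Submodule.fg_bot, by rw [Submodule.map_bot, LinearMap.range_zero]⟩⟩

theorem range_map_mono : Monotone fun s : FiniteStage A P Q => LinearMap.range s.map := by
  intro s t hst
  rintro _ ⟨x, rfl⟩
  obtain ⟨y, hy, hyx⟩ : s.map x ∈ s.dom.map s.map := s.map_dom ▸ ⟨x, rfl⟩
  exact ⟨y, (hst.2 hy).trans hyx⟩

theorem exists_le_mem_dom (s : FiniteStage A P Q) (x : P) : ∃ t, s ≤ t ∧ x ∈ t.dom := by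
  refine ⟨⟨s.map, s.dom ⊔ Submodule.span A {x}, s.fg_dom.sup (Submodule.fg_span_singleton x), ?_⟩,
    ⟨le_sup_left, fun _ _ => rfl⟩, Submodule.mem_sup_right (Submodule.mem_span_singleton_self x)⟩
  exact le_antisymm (LinearMap.map_le_range)
    (s.map_dom.ge.trans (Submodule.map_mono le_sup_left))

variable [IsNoetherianRing A]

theorem exists_le_smul_mem_range (s : FiniteStage A P Q) {g : P →ₗ[A] A}
    (hg : s.dom ≤ LinearMap.ker g) (q : Q) :
    ∃ t, s ≤ t ∧ ∀ x, g x • q ∈ LinearMap.range t.map := by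
  let f : P →ₗ[A] Q := s.map + g.smulRight q
  have hf : Set.EqOn f s.map s.dom := fun x hx => by
    have hgx : g x = 0 := hg hx
    simp [f, hgx]
  have hfg : (LinearMap.range f).FG := by
    refine fg_of_le_of_fg (Y := s.dom.map s.map ⊔ Submodule.span A {q}) ?_
      ((s.fg_dom.map _).sup (Submodule.fg_span_singleton q))
    rintro _ ⟨x, rfl⟩
    exact Submodule.add_mem_sup (s.map_dom ▸ ⟨x, rfl⟩)
      (Submodule.smul_mem _ _ (Submodule.mem_span_singleton_self q))
  obtain ⟨Z, hZ, hZf⟩ := exists_fg_map_eq hfg le_rfl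
  let t : FiniteStage A P Q := ⟨f, s.dom ⊔ Z, s.fg_dom.sup hZ,
    le_antisymm LinearMap.map_le_range (hZf.ge.trans (Submodule.map_mono le_sup_right))⟩
  have hst : s ≤ t := ⟨le_sup_left, hf⟩
  refine ⟨t, hst, fun x => ?_⟩
  have hgx : g x • q = f x - s.map x := by simp [f]
  rw [hgx]
  exact sub_mem ⟨x, rfl⟩ (range_map_mono hst ⟨x, rfl⟩)

variable {I : Ideal A}

theorem exists_le_forall_smul_mem_range (hI : ∀ X : Submodule A P, X.FG → I ≤ traceOf A (P ⧸ X))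
    (s : FiniteStage A P Q) (q : Q) :
    ∃ t, s ≤ t ∧ ∀ a ∈ I, a • q ∈ LinearMap.range t.map := by
  -- At a stage whose conductor is maximal, no homomorphism `P ⧸ t.dom → A` can enlarge the image.
  let conductor (t : FiniteStage A P Q) : Ideal A :=
    (LinearMap.range t.map).comap (LinearMap.toSpanSingleton A Q q)
  have hmono : Monotone conductor := fun _ _ h => Submodule.comap_mono (range_map_mono h)
  obtain ⟨t, hst, ht⟩ : ∃ t, s ≤ t ∧ ∀ u, t ≤ u → conductor u = conductor t := by
    obtain ⟨_, ⟨t, hst, rfl⟩, hmax⟩ := set_has_maximal_iff_noetherian.2 ‹IsNoetherianRing A›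
      (conductor '' Set.Ici s) ⟨_, s, Set.self_mem_Ici, rfl⟩
    exact ⟨t, hst, fun u htu =>
      (eq_of_le_of_not_lt (hmono htu) (hmax _ ⟨u, le_trans hst htu, rfl⟩)).symm⟩
  have htrace : traceOf A (P ⧸ t.dom) ≤ conductor t := traceOf_quotient_le_iff.2 fun g hg x => by
    obtain ⟨u, htu, hu⟩ := t.exists_le_smul_mem_range hg q
    exact ht u htu ▸ hu x
  exact ⟨t, hst, fun a ha => htrace (hI _ t.fg_dom ha)⟩

theorem exists_le_mem_range (hI : ∀ X : Submodule A P, X.FG → I ≤ traceOf A (P ⧸ X)) {y : Q}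
    (hy : y ∈ I • (⊤ : Submodule A Q)) (s : FiniteStage A P Q) :
    ∃ t, s ≤ t ∧ y ∈ LinearMap.range t.map := by
  refine Submodule.smul_induction_on (p := fun y => ∀ s : FiniteStage A P Q,
    ∃ t, s ≤ t ∧ y ∈ LinearMap.range t.map) hy (fun a ha q _ s => ?_) (fun y z hy hz s => ?_) s
  · obtain ⟨t, hst, ht⟩ := s.exists_le_forall_smul_mem_range hI q
    exact ⟨t, hst, ht a ha⟩
  · obtain ⟨t, hst, ht⟩ := hy s
    obtain ⟨u, htu, hu⟩ := hz t
    exact ⟨u, hst.trans htu, add_mem (range_map_mono htu ht) hu⟩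

end FiniteStage

theorem exists_surjective_of_le_traceOf_quotient [IsNoetherianRing A] (hP : IsCountablyGen A P)
    (hQ : IsCountablyGen A Q) {I : Ideal A}
    (hI : ∀ X : Submodule A P, X.FG → I ≤ traceOf A (P ⧸ X))
    (hIQ : I • (⊤ : Submodule A Q) = ⊤) : ∃ f : P →ₗ[A] Q, Function.Surjective f := by
  obtain ⟨x, hx⟩ := hP.exists_seq
  obtain ⟨y, hy⟩ := hQ.exists_seq
  have hnext : ∀ (n : ℕ) (s : FiniteStage A P Q),
      ∃ t, s ≤ t ∧ x n ∈ t.dom ∧ y n ∈ LinearMap.range t.map := fun n s => by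
    obtain ⟨t, hst, ht⟩ := s.exists_le_mem_range hI (y := y n) (hIQ.ge Submodule.mem_top)
    obtain ⟨u, htu, hu⟩ := t.exists_le_mem_dom (x n)
    exact ⟨u, hst.trans htu, hu, FiniteStage.range_map_mono htu ht⟩
  choose next le_next mem_dom mem_range using hnext
  let s : ℕ → FiniteStage A P Q := fun n => n.rec default next
  have hs : Monotone s := monotone_nat_of_le_succ fun n => le_next n (s n)
  have hdom : Monotone fun n => (s n).dom := fun _ _ h => (hs h).1
  have hexhaust : ∀ p, ∃ n, p ∈ (s n).dom := fun p => by
    have htop : ⨆ n, (s n).dom = ⊤ := by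
      rw [eq_top_iff, ← hx, Submodule.span_le]
      rintro _ ⟨n, rfl⟩
      exact Submodule.mem_iSup_of_mem (n + 1) (mem_dom n (s n))
    exact (Submodule.mem_iSup_of_directed _ hdom.directed_le).1 (htop.ge Submodule.mem_top)
  obtain ⟨f, hf⟩ := exists_linearMap_forall_eqOn (f := fun n => (s n).map) hdom hexhaust
    fun n => (le_next n (s n)).2
  refine ⟨f, LinearMap.range_eq_top.1 (eq_top_iff.2 ?_)⟩
  rw [← hy, Submodule.span_le]
  rintro _ ⟨n, rfl⟩
  have hyn : y n ∈ (s (n + 1)).dom.map (s (n + 1)).map :=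
    (s (n + 1)).map_dom ▸ mem_range n (s n)
  obtain ⟨p, hp, hpy⟩ := hyn
  exact ⟨p, (hf (n + 1) hp).trans hpy⟩

theorem IsBig.of_le_traceOf_quotient [IsNoetherianRing A] (hP : IsCountablyGen A P) {I : Ideal A}
    (hI : ∀ X : Submodule A P, X.FG → I ≤ traceOf A (P ⧸ X)) : IsBig I P :=
  fun _ hQ _ hIQ => exists_surjective_of_le_traceOf_quotient hP hQ hI hIQ

end Stages

section DirectSums

variable {A : Type u} [Ring A] {P W : Type u} [AddCommGroup P] [Module A P]
  [AddCommGroup W] [Module A W] {ι : Type*}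

instance projective_finsupp [Module.Projective A W] : Module.Projective A (ι →₀ W) := by
  classical
  exact Module.Projective.of_equiv (finsuppLequivDFinsupp A).symm

variable [Infinite ι]

theorem exists_forall_mem_apply_eq_zero_of_fg {X : Submodule A (ι →₀ W)} (hX : X.FG) :
    ∃ i, ∀ x ∈ X, x i = 0 := by
  classical
  obtain ⟨s, rfl⟩ := hX
  obtain ⟨i, hi⟩ := Infinite.exists_notMem_finset (s.biUnion fun x => x.support)
  refine ⟨i, fun x hx => ?_⟩
  have hle : Submodule.span A (s : Set (ι →₀ W)) ≤ LinearMap.ker (Finsupp.lapply (R := A) i) :=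
    Submodule.span_le.2 fun y hy => by
      by_contra h
      exact hi (Finset.mem_biUnion.2 ⟨y, hy, Finsupp.mem_support_iff.2 h⟩)
  exact hle hx

theorem exists_surjective_le_ker_of_fg {f : P →ₗ[A] (ι →₀ W)} (hf : Function.Surjective f)
    {X : Submodule A P} (hX : X.FG) :
    ∃ g : P →ₗ[A] W, Function.Surjective g ∧ X ≤ LinearMap.ker g := by
  obtain ⟨i, hi⟩ := exists_forall_mem_apply_eq_zero_of_fg (hX.map f)
  exact ⟨Finsupp.lapply i ∘ₗ f, (Finsupp.apply_surjective i).comp hf,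
    fun x hx => hi _ ⟨x, hx, rfl⟩⟩

theorem traceOf_le_traceOf_quotient {f : P →ₗ[A] (ι →₀ W)} (hf : Function.Surjective f)
    {X : Submodule A P} (hX : X.FG) : traceOf A W ≤ traceOf A (P ⧸ X) := by
  obtain ⟨g, hg, hgX⟩ := exists_surjective_le_ker_of_fg hf hX
  exact traceOf_le_of_surjective (X.liftQ g hgX) fun w => (hg w).imp' X.mkQ fun _ h => h

end DirectSums

section Absorption

variable {A : Type u} [Ring A] {P Q W : Type u} [AddCommGroup P] [Module A P]
  [AddCommGroup Q] [Module A Q] [AddCommGroup W] [Module A W] {I : Ideal A}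

theorem IsBig.exists_surjective_finsupp (hP : IsBig I P) [Module.Projective A W]
    (hW : IsCountablyGen A W) (hIW : I • (⊤ : Submodule A W) = ⊤) :
    ∃ f : P →ₗ[A] (ℕ →₀ W), Function.Surjective f :=
  hP (ModuleCat.of A (ℕ →₀ W)) (hW.finsupp ℕ) projective_finsupp (smul_top_finsupp hIW)

theorem IsBig.traceOf_le [Module.Projective A W] (hW : IsCountablyGen A W)
    (hP : IsBig (traceOf A W) P) {J : Ideal A} [J.IsTwoSided] {X : Submodule A P} (hX : X.FG)
    (hXJ : X ⊔ J • ⊤ = ⊤) : traceOf A W ≤ J := by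
  obtain ⟨f, hf⟩ := hP.exists_surjective_finsupp hW traceOf_smul_top
  obtain ⟨g, hg, hgX⟩ := exists_surjective_le_ker_of_fg hf hX
  refine traceOf_le_of_smul_top ?_
  have hmap := congrArg (Submodule.map g) hXJ
  rwa [Submodule.map_sup, LinearMap.le_ker_iff_map.1 hgX, bot_sup_eq, Submodule.map_smul'',
    Submodule.map_top, LinearMap.range_eq_top.2 hg] at hmap

theorem exists_retraction_ker_of_surjective [Module.Projective A Q] {f : P →ₗ[A] Q}
    (hf : Function.Surjective f) :
    ∃ p : P →ₗ[A] LinearMap.ker f, p ∘ₗ (LinearMap.ker f).subtype = LinearMap.id := by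
  obtain ⟨s, hs⟩ := Module.projective_lifting_property f LinearMap.id hf
  have hfs : ∀ q, f (s q) = q := fun q => LinearMap.congr_fun hs q
  refine ⟨LinearMap.codRestrict _ (LinearMap.id - s ∘ₗ f) fun x => by simp [hfs],
    LinearMap.ext fun x => Subtype.ext ?_⟩
  have hfx : f x = 0 := x.2
  simp [hfx]

theorem nonempty_equiv_ker_prod_of_surjective [Module.Projective A Q] {f : P →ₗ[A] Q}
    (hf : Function.Surjective f) : Nonempty ((LinearMap.ker f × Q) ≃ₗ[A] P) := by
  obtain ⟨s, hs⟩ := Module.projective_lifting_property f LinearMap.id hf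
  exact ⟨lequivProdOfRightSplitExact (LinearMap.ker f).injective_subtype
    (Submodule.range_subtype _) hs⟩

theorem nonempty_finsupp_nat_equiv_prod : Nonempty ((ℕ →₀ Q) ≃ₗ[A] (ℕ →₀ Q) × Q) :=
  ⟨(Finsupp.domLCongr Equiv.natSumPUnitEquivNat.{0}.symm).trans
    ((Finsupp.sumFinsuppLEquivProdFinsupp A).trans
      ((LinearEquiv.refl A _).prodCongr (Finsupp.uniqueLinearEquiv A Q PUnit.unit.{1})))⟩

theorem IsBig.nonempty_equiv_prod (hP : IsBig I P) [Module.Projective A Q]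
    (hQ : IsCountablyGen A Q) (hIQ : I • (⊤ : Submodule A Q) = ⊤) :
    Nonempty (P ≃ₗ[A] P × Q) := by
  obtain ⟨f, hf⟩ := hP.exists_surjective_finsupp hQ hIQ
  obtain ⟨e⟩ := nonempty_equiv_ker_prod_of_surjective hf
  obtain ⟨swindle⟩ := nonempty_finsupp_nat_equiv_prod (A := A) (Q := Q)
  exact ⟨e.symm.trans (((LinearEquiv.refl A _).prodCongr swindle).trans
    ((LinearEquiv.prodAssoc A _ _ _).symm.trans (e.prodCongr (LinearEquiv.refl A _))))⟩

end Absorption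

section Uniqueness

variable {A : Type u} [Ring A] {P Q W L : Type u} [AddCommGroup P] [Module A P]
  [AddCommGroup Q] [Module A Q] [AddCommGroup W] [Module A W] [AddCommGroup L] [Module A L]
  {I : Ideal A}

theorem exists_surjective_smul_top_of_traceOf [IsNoetherianRing A] [Module.Projective A W]
    (hW : IsCountablyGen A W) (hQ : IsCountablyGen A Q) :
    ∃ w : (ℕ →₀ W) →ₗ[A] ↥(traceOf A W • (⊤ : Submodule A Q)), Function.Surjective w := by
  set N : Submodule A Q := traceOf A W • ⊤ with hN
  have hNI : traceOf A W • (⊤ : Submodule A N) = ⊤ := by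
    refine Submodule.map_injective_of_injective N.injective_subtype ?_
    rw [Submodule.map_smul'', Submodule.map_top, Submodule.range_subtype, hN,
      ← Submodule.mul_smul, traceOf_mul_self]
  exact exists_surjective_of_le_traceOf_quotient (hW.finsupp ℕ) (hQ.submodule N)
    (fun X hX => traceOf_le_traceOf_quotient (f := LinearMap.id) Function.surjective_id hX) hNI

theorem exists_surjective_prod_ker_le_smul_top [Module.Projective A P]
    (hIL : I • (⊤ : Submodule A L) = ⊤) {w : L →ₗ[A] ↥(I • (⊤ : Submodule A Q))}
    (hw : Function.Surjective w)
    (e : (P ⧸ I • (⊤ : Submodule A P)) ≃ₗ[A] (Q ⧸ I • (⊤ : Submodule A Q))) :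
    ∃ g : P × L →ₗ[A] Q, Function.Surjective g ∧ LinearMap.ker g ≤ I • ⊤ := by
  obtain ⟨h, hh⟩ := Module.projective_lifting_property (Submodule.mkQ _)
    (e.toLinearMap ∘ₗ Submodule.mkQ _) (Submodule.mkQ_surjective _)
  have hh : ∀ p, Submodule.Quotient.mk (h p) = e (Submodule.Quotient.mk p) :=
    LinearMap.congr_fun hh
  refine ⟨h.coprod (Submodule.subtype _ ∘ₗ w), fun q => ?_, fun x hx => ?_⟩
  · obtain ⟨p, hp⟩ := e.surjective (Submodule.Quotient.mk q)
    obtain ⟨p, rfl⟩ := Submodule.Quotient.mk_surjective _ p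
    obtain ⟨z, hz⟩ := hw ⟨q - h p, (Submodule.Quotient.eq _).1 (hp.symm.trans (hh p).symm)⟩
    exact ⟨(p, z), by simp [hz]⟩
  · have hx : h x.1 + w x.2 = 0 := hx
    refine mem_smul_top_prod ?_ (hIL.ge Submodule.mem_top)
    rw [← Submodule.Quotient.mk_eq_zero, ← map_eq_zero_iff e e.injective, ← hh,
      Submodule.Quotient.mk_eq_zero, eq_neg_of_add_eq_zero_left hx]
    exact Submodule.neg_mem _ (w x.2).2

theorem ker_smul_top_of_le_smul_top [Module.Projective A Q] {g : P →ₗ[A] Q}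
    (hg : Function.Surjective g) (hgI : LinearMap.ker g ≤ I • ⊤) :
    I • (⊤ : Submodule A (LinearMap.ker g)) = ⊤ := by
  obtain ⟨π, hπ⟩ := exists_retraction_ker_of_surjective hg
  refine eq_top_iff.2 fun x _ => ?_
  have hπx : π x = x := LinearMap.congr_fun hπ x
  exact hπx ▸ map_mem_smul_top π (hgI x.2)

theorem IsBig.nonempty_equiv [IsNoetherianRing A] [Module.Projective A W]
    [Module.Projective A P] [Module.Projective A Q] (hW : IsCountablyGen A W)
    (hP : IsCountablyGen A P) (hQ : IsCountablyGen A Q) (hPbig : IsBig (traceOf A W) P)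
    (hQbig : IsBig (traceOf A W) Q)
    (e : (P ⧸ traceOf A W • (⊤ : Submodule A P)) ≃ₗ[A] (Q ⧸ traceOf A W • (⊤ : Submodule A Q))) :
    Nonempty (P ≃ₗ[A] Q) := by
  have hWsum : traceOf A W • (⊤ : Submodule A (ℕ →₀ W)) = ⊤ := smul_top_finsupp traceOf_smul_top
  obtain ⟨w, hw⟩ := exists_surjective_smul_top_of_traceOf hW hQ
  obtain ⟨g, hg, hgI⟩ := exists_surjective_prod_ker_le_smul_top hWsum hw e
  obtain ⟨π, hπ⟩ := exists_retraction_ker_of_surjective hg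
  have hK : IsCountablyGen A (LinearMap.ker g) := (hP.prod (hW.finsupp ℕ)).of_surjective π
    fun x => ⟨x, LinearMap.congr_fun hπ x⟩
  have : Module.Projective A (LinearMap.ker g) := Module.Projective.of_split _ π hπ
  obtain ⟨eP⟩ := hPbig.nonempty_equiv_prod (hW.finsupp ℕ) hWsum
  obtain ⟨eg⟩ := nonempty_equiv_ker_prod_of_surjective hg
  obtain ⟨eQ⟩ := hQbig.nonempty_equiv_prod hK (ker_smul_top_of_le_smul_top hg hgI)
  exact ⟨eP.trans (eg.symm.trans ((LinearEquiv.prodComm A _ _).trans eQ.symm))⟩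

end Uniqueness

section Telescope

variable {A : Type u} [Ring A]

theorem projective_of_exhaustion {P F : Type*} [AddCommGroup P] [Module A P]
    [AddCommGroup F] [Module A F] [Module.Projective A F] {X : ℕ → Submodule A P}
    (hX : Monotone X) (hXtop : ∀ p, ∃ n, p ∈ X n) {r : ℕ → P →ₗ[A] F} {j : ℕ → F →ₗ[A] P}
    (hr : ∀ n, ∀ p ∈ X n, j n (r n p) = p) (hj : ∀ n y, j n y ∈ X (n + 1)) :
    Module.Projective A P := by
  let π : (P →₀ A) →ₗ[A] P := Finsupp.linearCombination A id
  choose g hg using fun n =>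
    Module.projective_lifting_property π (j n) (Finsupp.linearCombination_id_surjective A P)
  have hg : ∀ n y, π (g n y) = j n y := fun n => LinearMap.congr_fun (hg n)
  -- Each correction term vanishes on `X n`, where `j n ∘ r n` is the identity.
  let s : ℕ → P →ₗ[A] (P →₀ A) := Nat.rec (g 0 ∘ₗ r 0) fun n t =>
    t + g (n + 1) ∘ₗ r (n + 1) ∘ₗ (LinearMap.id - j n ∘ₗ r n)
  have hs : ∀ n p, s (n + 1) p = s n p + g (n + 1) (r (n + 1) (p - j n (r n p))) :=
    fun _ _ => rfl
  have hπs : ∀ n p, π (s n p) = j n (r n p) := by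
    intro n p
    induction n with
    | zero => exact hg 0 (r 0 p)
    | succ n ih => rw [hs, map_add, ih, hg, map_sub, map_sub, hr (n + 1) _ (hj n _),
        add_sub_cancel]
  obtain ⟨t, ht⟩ := exists_linearMap_forall_eqOn hX hXtop (f := s) fun n p hp => by
    simp only [hs, hr n p hp, sub_self, map_zero, add_zero]
  refine Module.Projective.of_split t π (LinearMap.ext fun p => ?_)
  obtain ⟨n, hn⟩ := hXtop p
  rw [LinearMap.comp_apply, ht n hn, hπs, hr n p hn, LinearMap.id_apply]

variable {F : Type u} [AddCommGroup F] [Module A F]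

/-- The direct limit of the sequence `F → F → F → ⋯` with all maps equal to `φ`. -/
abbrev Telescope (φ : Module.End A F) : Type u :=
  Module.DirectLimit (fun _ : ℕ => F) (fun i j _ => φ ^ (j - i))

namespace Telescope

/-- The canonical map of the `k`-th term to the direct limit. -/
noncomputable abbrev of (φ : Module.End A F) (k : ℕ) : F →ₗ[A] Telescope φ :=
  Module.DirectLimit.of A ℕ (fun _ => F) (fun i j _ => φ ^ (j - i)) k

variable {φ : Module.End A F}

theorem of_succ (k : ℕ) (x : F) : of φ (k + 1) (φ x) = of φ k x := by
  have hf := Module.DirectLimit.of_f (R := A) (G := fun _ : ℕ => F)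
    (f := fun i j _ => φ ^ (j - i)) (hij := Nat.le_succ k) (x := x)
  rwa [Nat.succ_eq_add_one, Nat.add_sub_cancel_left, pow_one] at hf

theorem exists_of (z : Telescope φ) : ∃ k x, of φ k x = z :=
  Module.DirectLimit.exists_of z

variable {Q : Type*} [AddCommGroup Q] [Module A Q]

/-- The map out of the direct limit induced by a compatible sequence of maps. -/
noncomputable def lift (g : ℕ → F →ₗ[A] Q) (hg : ∀ k x, g (k + 1) (φ x) = g k x) :
    Telescope φ →ₗ[A] Q :=
  Module.DirectLimit.lift A ℕ _ _ g fun i j hij x => by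
    obtain ⟨d, rfl⟩ := Nat.exists_eq_add_of_le hij
    rw [Nat.add_sub_cancel_left]
    induction d generalizing x with
    | zero => rfl
    | succ d ih =>
      rw [pow_succ', Module.End.mul_apply, ← Nat.add_assoc, hg]
      exact ih x (Nat.le_add_right _ _)

theorem lift_of (g : ℕ → F →ₗ[A] Q) (hg : ∀ k x, g (k + 1) (φ x) = g k x) (k : ℕ) (x : F) :
    lift g hg (of φ k x) = g k x :=
  Module.DirectLimit.lift_of _ _ _

theorem isCountablyGen (hF : IsCountablyGen A F) : IsCountablyGen A (Telescope φ) := by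
  refine (hF.finsupp ℕ).of_surjective (Finsupp.lsum ℕ (of φ)) fun z => ?_
  obtain ⟨k, x, rfl⟩ := exists_of z
  exact ⟨Finsupp.single k x, by simp⟩

theorem exists_retraction {ψ : Module.End A F} (h : ψ * φ * φ = φ) (k : ℕ) :
    ∃ r : Telescope φ →ₗ[A] F, ∀ x, r (of φ k x) = φ x := by
  let shift : Module.End A (Telescope φ) := lift (fun k => of φ k ∘ₗ φ) fun k x => of_succ k (φ x)
  have hshift : ∀ k x, (shift ^ k) (of φ k x) = of φ 0 x := by
    intro k
    induction k with
    | zero => exact fun x => rfl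
    | succ k ih =>
      intro x
      rw [pow_succ, Module.End.mul_apply, lift_of, LinearMap.comp_apply, of_succ, ih]
  let r : Telescope φ →ₗ[A] F := lift (fun k => ψ ^ k * φ) fun k x =>
    LinearMap.congr_fun (f := ψ ^ (k + 1) * φ * φ) (by rw [pow_succ, mul_assoc, mul_assoc,
      ← mul_assoc ψ, h]) x
  exact ⟨r ∘ₗ shift ^ k, fun x => by rw [LinearMap.comp_apply, hshift, lift_of, pow_zero, one_mul]⟩

theorem projective [Module.Projective A F] {ψ : Module.End A F} (h : ψ * φ * φ = φ) :
    Module.Projective A (Telescope φ) := by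
  choose r hr using exists_retraction h
  refine projective_of_exhaustion (X := fun k => LinearMap.range (of φ k)) (r := r)
    (j := fun k => of φ (k + 1)) (monotone_nat_of_le_succ fun k => ?_) exists_of ?_
    fun k y => ⟨y, rfl⟩
  · rintro _ ⟨x, rfl⟩
    exact ⟨φ x, of_succ k x⟩
  · rintro k _ ⟨x, rfl⟩
    rw [hr, of_succ]

end Telescope

end Telescope

section Words

variable {A : Type u} [Ring A] {Y : Type u} [AddCommGroup Y] [Module A Y] {κ : Type} [Fintype κ]

/-- The endomorphism of the module of finitely supported `Y`-valued functions on words in `κ` that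
applies `ε` to the value at the empty word, and also moves a value `y` at a word `w` to the values
`X j y` at the words `j :: w`. Its telescope realizes `ε` as an idempotent when `ε` is idempotent
up to composites of two of the maps `X j`. -/
noncomputable def wordShift (ε : Module.End A Y) (X : κ → Module.End A Y) :
    Module.End A (List κ →₀ Y) :=
  Finsupp.lsum ℕ fun w => ∑ j, Finsupp.lsingle (j :: w) ∘ₗ X j +
    match w with
    | [] => Finsupp.lsingle [] ∘ₗ ε
    | _ :: _ => 0

/-- A left inverse of `wordShift ε X` on its image, when `X k = ∑ j l, γ k j l ∘ X l ∘ X j` and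
`ε - ε ∘ ε = ∑ j l, δ j l ∘ X l ∘ X j`. -/
noncomputable def wordUnshift (γ : κ → κ → κ → Module.End A Y) (δ : κ → κ → Module.End A Y) :
    Module.End A (List κ →₀ Y) :=
  Finsupp.lsum ℕ fun
    | [] => Finsupp.lsingle []
    | [_] => 0
    | l :: j :: w => ∑ k, Finsupp.lsingle (k :: w) ∘ₗ γ k j l +
      match w with
      | [] => Finsupp.lsingle [] ∘ₗ δ j l
      | _ :: _ => 0

variable {ε : Module.End A Y} {X : κ → Module.End A Y}

theorem wordShift_single_nil (y : Y) : wordShift ε X (Finsupp.single [] y) =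
    ∑ j, Finsupp.single [j] (X j y) + Finsupp.single [] (ε y) := by
  simp [wordShift]

theorem wordShift_single_cons (i : κ) (w : List κ) (y : Y) :
    wordShift ε X (Finsupp.single (i :: w) y) = ∑ j, Finsupp.single (j :: i :: w) (X j y) := by
  simp [wordShift]

theorem wordShift_apply_nil (v : List κ →₀ Y) : wordShift ε X v [] = ε (v []) := by
  induction v using Finsupp.induction_linear with
  | zero => simp
  | add v w hv hw => simp [hv, hw]
  | single w y => cases w <;> simp [wordShift_single_nil, wordShift_single_cons]

theorem wordShift_apply_cons (v : List κ →₀ Y) (j : κ) (w : List κ) :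
    wordShift ε X v (j :: w) = X j (v w) := by
  classical
  induction v using Finsupp.induction_linear with
  | zero => simp
  | add v w hv hw => simp [hv, hw]
  | single w' y =>
    obtain rfl | h := eq_or_ne w' w
    · cases w' <;> simp [wordShift_single_nil, wordShift_single_cons, Finsupp.single_apply]
    · cases w' <;> simp [wordShift_single_nil, wordShift_single_cons, h]

variable {γ : κ → κ → κ → Module.End A Y} {δ : κ → κ → Module.End A Y}

theorem wordUnshift_single_nil (y : Y) :
    wordUnshift γ δ (Finsupp.single [] y) = Finsupp.single [] y := by
  simp [wordUnshift]

theorem wordUnshift_single_singleton (j : κ) (y : Y) :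
    wordUnshift γ δ (Finsupp.single [j] y) = 0 := by
  simp [wordUnshift]

theorem wordUnshift_single_pair (l j : κ) (y : Y) :
    wordUnshift γ δ (Finsupp.single [l, j] y) =
      ∑ k, Finsupp.single [k] (γ k j l y) + Finsupp.single [] (δ j l y) := by
  simp [wordUnshift]

theorem wordUnshift_single_cons (l j i : κ) (w : List κ) (y : Y) :
    wordUnshift γ δ (Finsupp.single (l :: j :: i :: w) y) =
      ∑ k, Finsupp.single (k :: i :: w) (γ k j l y) := by
  simp [wordUnshift]

theorem wordUnshift_mul_wordShift
    (hγ : ∀ k y, X k y = ∑ j, ∑ l, γ k j l (X l (X j y)))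
    (hδ : ∀ y, ε y - ε (ε y) = ∑ j, ∑ l, δ j l (X l (X j y))) :
    wordUnshift γ δ * wordShift ε X * wordShift ε X = wordShift ε X := by
  have hX : ∀ (w : List κ) y, ∑ j, ∑ l, ∑ k, Finsupp.single (k :: w) (γ k j l (X l (X j y))) =
      ∑ k, Finsupp.single (k :: w) (X k y) := fun w y => by
    rw [Finset.sum_congr rfl fun j _ => Finset.sum_comm, Finset.sum_comm]
    refine Finset.sum_congr rfl fun k _ => ?_
    rw [hγ k y]
    simp only [Finsupp.single_finsetSum]
  refine Finsupp.lhom_ext fun w y => ?_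
  rcases w with _ | ⟨k, w⟩
  · have hδy : ∑ j, ∑ l, Finsupp.single ([] : List κ) (δ j l (X l (X j y))) =
        Finsupp.single [] (ε y) - Finsupp.single [] (ε (ε y)) := by
      rw [← Finsupp.single_sub, hδ]
      simp only [Finsupp.single_finsetSum]
    simp only [Module.End.mul_apply, wordShift_single_nil, wordShift_single_cons, map_add, map_sum,
      wordUnshift_single_nil, wordUnshift_single_singleton, wordUnshift_single_pair,
      Finset.sum_add_distrib, Finset.sum_const_zero, hX, hδy]
    abel
  · simp only [Module.End.mul_apply, wordShift_single_cons, map_sum, wordUnshift_single_cons, hX]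

end Words

section Lifting

variable {A : Type u} [Ring A] {I : Ideal A}

theorem Telescope.nonempty_quotient_equiv {F Q : Type u} [AddCommGroup F] [Module A F]
    [AddCommGroup Q] [Module A Q] {φ : Module.End A F} {q : F →ₗ[A] Q}
    (hq : Function.Surjective q) (hqφ : ∀ v, q (φ v) = q v)
    (hker : ∀ v, q v = 0 → φ v ∈ I • (⊤ : Submodule A F)) (hIQ : I • (⊤ : Submodule A Q) = ⊥) :
    Nonempty ((Telescope φ ⧸ I • (⊤ : Submodule A (Telescope φ))) ≃ₗ[A] Q) := by
  let τ : Telescope φ →ₗ[A] Q := Telescope.lift (fun _ => q) fun _ => hqφ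
  have hτ : ∀ k v, τ (of φ k v) = q v := lift_of _ _
  have hτs : Function.Surjective τ := hq.forall.2 fun v => ⟨of φ 0 v, hτ 0 v⟩
  have hkerτ : I • (⊤ : Submodule A (Telescope φ)) = LinearMap.ker τ := by
    refine le_antisymm (fun z hz => hIQ.le (map_mem_smul_top τ hz)) fun z hz => ?_
    obtain ⟨k, v, rfl⟩ := exists_of z
    rw [← of_succ]
    exact map_mem_smul_top _ (hker v ((hτ k v).symm.trans hz))
  exact ⟨(Submodule.quotEquivOfEq _ _ hkerτ).trans (τ.quotKerEquivOfSurjective hτs)⟩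

theorem mem_smul_top_of_forall_mem {ι : Type*} [Finite ι] {y : ι → A} (hy : ∀ i, y i ∈ I) :
    y ∈ I • (⊤ : Submodule A (ι → A)) := by
  classical
  have := Fintype.ofFinite ι
  rw [pi_eq_sum_univ' y]
  exact Submodule.sum_mem _ fun i _ => Submodule.smul_mem_smul (hy i) trivial

theorem mem_smul_top_finsupp {ι Y : Type*} [AddCommGroup Y] [Module A Y] {v : ι →₀ Y}
    (hv : ∀ i, v i ∈ I • (⊤ : Submodule A Y)) : v ∈ I • (⊤ : Submodule A (ι →₀ Y)) := by
  rw [← Finsupp.sum_single v]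
  exact Submodule.sum_mem _ fun i _ => map_mem_smul_top (Finsupp.lsingle i) (hv i)

variable {κ : Type} [Fintype κ] {x : κ → A}

theorem exists_eq_sum_mul_mul (hII : I * I = I)
    (hx : ∀ a ∈ I, ∃ c : κ → A, a = ∑ j, x j * c j) {a : A} (ha : a ∈ I) :
    ∃ c : κ → κ → A, a = ∑ j, ∑ l, x j * x l * c j l := by
  rw [← hII] at ha
  refine Submodule.mul_induction_on ha (fun b hb b' hb' => ?_) ?_
  · obtain ⟨c, rfl⟩ := hx b hb
    choose e he using fun j => hx _ (I.mul_mem_left (c j) hb')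
    exact ⟨e, by simp_rw [Finset.sum_mul, mul_assoc, he, Finset.mul_sum]⟩
  · rintro _ _ ⟨c, rfl⟩ ⟨c', rfl⟩
    exact ⟨c + c', by simp [mul_add, Finset.sum_add_distrib]⟩

variable {ι : Type} [Finite ι]

theorem exists_linearMap_eq_sum_mul_mul (hII : I * I = I)
    (hx : ∀ a ∈ I, ∃ c : κ → A, a = ∑ j, x j * c j) {θ : Module.End A (ι → A)}
    (hθ : ∀ y i, θ y i ∈ I) :
    ∃ δ : κ → κ → Module.End A (ι → A),
      ∀ y, θ y = ∑ j, ∑ l, δ j l (MulOpposite.op (x l) • MulOpposite.op (x j) • y) := by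
  classical
  have := Fintype.ofFinite ι
  choose d hd using fun i k => exists_eq_sum_mul_mul hII hx (hθ (Pi.single i 1) k)
  refine ⟨fun j l => Fintype.linearCombination A fun i k => d i k j l, fun y => ?_⟩
  have hθy : θ y = ∑ i, y i • θ (Pi.single i 1) := by
    conv_lhs => rw [pi_eq_sum_univ' y, map_sum]
    simp only [map_smul]
  ext k
  simp only [hθy, Fintype.linearCombination_apply, Finset.sum_apply, Pi.smul_apply, smul_eq_mul,
    hd, Finset.mul_sum, MulOpposite.smul_eq_mul_unop, MulOpposite.unop_op, mul_assoc]
  rw [Finset.sum_comm]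
  exact Finset.sum_congr rfl fun j _ => Finset.sum_comm

theorem exists_lift_projection {Q : Type u} [AddCommGroup Q] [Module A Q]
    (hQ : IsSummand A Q (ι → A ⧸ I)) :
    ∃ (ε : Module.End A (ι → A)) (q : (ι → A) →ₗ[A] Q), Function.Surjective q ∧
      (∀ y, q (ε y) = q y) ∧ ∀ y, q y = 0 → ∀ k, ε y k ∈ I := by
  obtain ⟨i, p, hpi⟩ := hQ
  have hpi : ∀ q, p (i q) = q := LinearMap.congr_fun hpi
  let π : (ι → A) →ₗ[A] (ι → A ⧸ I) := I.mkQ.compLeft ι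
  have hπ : Function.Surjective π := I.mkQ_surjective.comp_left
  obtain ⟨ε, hε⟩ := Module.projective_lifting_property π (i ∘ₗ p ∘ₗ π) hπ
  have hε : ∀ y, π (ε y) = i (p (π y)) := LinearMap.congr_fun hε
  refine ⟨ε, p ∘ₗ π, (Function.LeftInverse.surjective hpi).comp hπ, fun y => ?_, fun y hy k => ?_⟩
  · rw [LinearMap.comp_apply, hε, hpi, LinearMap.comp_apply]
  · have hεy : π (ε y) = 0 := by rw [hε, show p (π y) = 0 from hy, map_zero]
    exact (Submodule.Quotient.mk_eq_zero I).1 (congrFun hεy k)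

theorem IsSummand.smul_top_eq_bot {ι : Type} [I.IsTwoSided] {Q : Type u} [AddCommGroup Q]
    [Module A Q] (hQ : IsSummand A Q (ι → A ⧸ I)) : I • (⊤ : Submodule A Q) = ⊥ := by
  obtain ⟨i, p, hpi⟩ := hQ
  refine (Submodule.smul_le (P := ⊥)).2 (fun a ha z _ => ?_) |> le_bot_iff.1
  have hi : i (a • z) = 0 := by
    rw [map_smul]
    funext k
    obtain ⟨b, hb⟩ := Submodule.Quotient.mk_surjective I (i z k)
    rw [Pi.smul_apply, ← hb, ← Submodule.Quotient.mk_smul]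
    exact (Submodule.Quotient.mk_eq_zero I).2 (I.mul_mem_right b ha)
  rw [Submodule.mem_bot, ← LinearMap.id_apply (R := A) (a • z), ← hpi, LinearMap.comp_apply, hi,
    map_zero]

theorem exists_projective_lift [I.IsTwoSided] (hII : I * I = I) (hxI : ∀ j, x j ∈ I)
    (hx : ∀ a ∈ I, ∃ c : κ → A, a = ∑ j, x j * c j) {Q : Type u} [AddCommGroup Q] [Module A Q]
    (hQ : IsSummand A Q (ι → A ⧸ I)) :
    ∃ P : ModuleCat.{u} A, IsCountablyGen A P ∧ Module.Projective A P ∧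
      Nonempty ((P ⧸ I • (⊤ : Submodule A P)) ≃ₗ[A] Q) ∧ (Nonempty ι → I ≤ traceOf A P) := by
  classical
  obtain ⟨ε, q, hq, hqε, hεI⟩ := exists_lift_projection hQ
  let X : κ → Module.End A (ι → A) := fun j =>
    DistribSMul.toLinearMap A (ι → A) (MulOpposite.op (x j))
  have hXI : ∀ j y k, X j y k ∈ I := fun j y k => I.mul_mem_left (y k) (hxI j)
  choose γ hγ using fun k => exists_linearMap_eq_sum_mul_mul hII hx (hXI k)
  have hεε : ∀ y k, (ε - ε * ε) y k ∈ I := fun y k => by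
    simpa using hεI (y - ε y) (by rw [map_sub q, hqε, sub_self]) k
  obtain ⟨δ, hδ⟩ := exists_linearMap_eq_sum_mul_mul hII hx hεε
  have hφ := wordUnshift_mul_wordShift (ε := ε) (X := X) hγ hδ
  refine ⟨ModuleCat.of A (Telescope (wordShift ε X)),
    Telescope.isCountablyGen (IsCountablyGen.of_finite.finsupp _), Telescope.projective hφ,
    Telescope.nonempty_quotient_equiv (q := q ∘ₗ Finsupp.lapply [])
      (hq.comp (Finsupp.apply_surjective [])) (fun v => ?_)
      (fun v hv => mem_smul_top_finsupp fun w => mem_smul_top_of_forall_mem ?_)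
      hQ.smul_top_eq_bot, ?_⟩
  · simp [wordShift_apply_nil, hqε]
  · rcases w with _ | ⟨j, w⟩
    · simpa only [wordShift_apply_nil, Finsupp.lapply_apply] using hεI _ hv
    · simpa only [wordShift_apply_cons] using hXI j _
  · rintro ⟨k⟩ a ha
    obtain ⟨r, hr⟩ := Telescope.exists_retraction hφ 0
    obtain ⟨c, rfl⟩ := hx a ha
    refine Ideal.sum_mem _ fun j _ => Ideal.mul_mem_right _ _ ?_
    have hxj := apply_mem_traceOf (LinearMap.proj k ∘ₗ Finsupp.lapply [j] ∘ₗ r)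
      (Telescope.of _ 0 (Finsupp.single [] (Pi.single k 1)))
    simpa [hr, wordShift_apply_cons, X] using hxj

end Lifting

section PrimeRings

/-- A (possibly noncommutative) ring `B` is prime if `a B b = 0` implies `a = 0` or `b = 0`. The
zero ring is allowed. -/
def IsPrimeRing (B : Type*) [Ring B] : Prop :=
  ∀ a b : B, (∀ c, a * c * b = 0) → a = 0 ∨ b = 0

theorem IsPrimeRing.eq_bot_of_isNilpotent {B : Type*} [Ring B] (hB : IsPrimeRing B) {J : Ideal B}
    (hJ : IsNilpotent J) : J = ⊥ := by
  obtain ⟨n, hn⟩ := hJ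
  by_contra hJ0
  obtain ⟨b, hb, hb0⟩ := (Submodule.ne_bot_iff J).1 hJ0
  induction n with
  | zero =>
    refine hb0 ((Submodule.mem_bot B).1 ?_)
    rw [Submodule.pow_zero, Ideal.one_eq_top, Submodule.zero_eq_bot] at hn
    exact hn ▸ trivial
  | succ n ih =>
    refine ih ((Submodule.eq_bot_iff _).2 fun a ha => (hB a b fun c => ?_).resolve_right hb0)
    have hmem : a * (c * b) ∈ J ^ (n + 1) := by
      rw [Submodule.pow_succ]
      exact Ideal.mul_mem_mul ha (J.mul_mem_left c hb)
    rwa [hn, Submodule.zero_eq_bot, Submodule.mem_bot, ← mul_assoc] at hmem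

theorem IsPrimeRing.isSemisimpleRing {B : Type*} [Ring B] [IsArtinianRing B]
    (hB : IsPrimeRing B) : IsSemisimpleRing B := by
  rw [IsArtinianRing.isSemisimpleRing_iff_jacobson, ← Ideal.jacobson_bot]
  exact hB.eq_bot_of_isNilpotent IsArtinianRing.isNilpotent_jacobson_bot

theorem IsPrimeRing.isSimpleRing {B : Type*} [Ring B] [Nontrivial B] [IsArtinianRing B]
    (hB : IsPrimeRing B) : IsSimpleRing B := by
  refine isSimpleRing_iff_isTwoSided_imp.2 ⟨‹_›, fun N _ => or_iff_not_imp_left.2 fun hN => ?_⟩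
  have := hB.isSemisimpleRing
  obtain ⟨N', hN'⟩ := exists_isCompl N
  obtain ⟨a, ha, ha0⟩ := (Submodule.ne_bot_iff N).1 hN
  have hN'0 : N' = ⊥ := by
    refine (Submodule.eq_bot_iff _).2 fun b hb => (hB a b fun c => ?_).resolve_left ha0
    have hmem : a * c * b ∈ N ⊓ N' :=
      ⟨N.mul_mem_right _ (N.mul_mem_right _ ha), N'.mul_mem_left _ hb⟩
    rwa [hN'.inf_eq_bot] at hmem
  rw [← sup_bot_eq N, ← hN'0, hN'.sup_eq_top]

theorem IsPrimeRing.eq_zero_or_eq_zero_of_smul_eq_zero {C B : Type*} [CommRing C] [Ring B]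
    [Algebra C B] [FaithfulSMul C B] (hB : IsPrimeRing B) {c : C} {b : B} (h : c • b = 0) :
    c = 0 ∨ b = 0 := by
  refine (hB (algebraMap C B c) b fun x => ?_).imp_left fun hc =>
    FaithfulSMul.algebraMap_injective C B (hc.trans (map_zero _).symm)
  rw [Algebra.commutes, mul_assoc, ← Algebra.smul_def, h, mul_zero]

theorem mem_range_algebraMap_of_forall_mul_comm (C : Type*) {B : Type*} [CommRing C] [Ring B]
    [Algebra C B] [Algebra.IsCentral C B] {z : B} (hz : ∀ x, z * x = x * z) :
    ∃ c, algebraMap C B c = z :=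
  Algebra.mem_bot.1 (Algebra.IsCentral.out (Subalgebra.mem_center_iff.2 fun x => (hz x).symm))

end PrimeRings

section CentralSimple

open scoped TensorProduct

variable (K D : Type*) [Field K] [Ring D] [Algebra K D]

attribute [local instance] instModuleTensorProductMop

theorem isSimpleModule_tensorProduct_mulOpposite [IsSimpleRing D] :
    IsSimpleModule (D ⊗[K] Dᵐᵒᵖ) D := by
  refine (isSimpleModule_iff _ _).2 { eq_bot_or_eq_top := fun N => ?_ }
  have hl : ∀ a, ∀ x ∈ N, a * x ∈ N := fun a x hx => by
    simpa [TensorProduct.Algebra.smul_def] using N.smul_mem (a ⊗ₜ[K] MulOpposite.op 1) hx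
  have hr : ∀ b, ∀ x ∈ N, x * b ∈ N := fun b x hx => by
    simpa [TensorProduct.Algebra.smul_def] using N.smul_mem (1 ⊗ₜ[K] MulOpposite.op b) hx
  let I : Ideal D := { N.toAddSubmonoid with smul_mem' := fun a x => hl a x }
  have hI : I.IsTwoSided := ⟨fun {x} b => hr b x⟩
  rcases (isSimpleRing_iff_isTwoSided_imp.1 ‹_›).2 I hI with h | h
  · exact Or.inl ((Submodule.eq_bot_iff _).2 ((Submodule.eq_bot_iff I).1 h))
  · exact Or.inr (Submodule.eq_top_iff'.2 ((Submodule.eq_top_iff' (p := I)).1 h))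

variable {K D} in
theorem exists_forall_end_apply_eq_smul [Algebra.IsCentral K D]
    (g : Module.End (D ⊗[K] Dᵐᵒᵖ) D) : ∃ k : K, ∀ x, g x = k • x := by
  have hl : ∀ a x, g (a * x) = a * g x := fun a x => by
    simpa [TensorProduct.Algebra.smul_def] using g.map_smul (a ⊗ₜ[K] MulOpposite.op 1) x
  have hr : ∀ b x, g (x * b) = g x * b := fun b x => by
    simpa [TensorProduct.Algebra.smul_def] using g.map_smul (1 ⊗ₜ[K] MulOpposite.op b) x
  obtain ⟨k, hk⟩ := mem_range_algebraMap_of_forall_mul_comm K (z := g 1) fun x => by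
    rw [← hr, ← hl, one_mul, mul_one]
  exact ⟨k, fun x => by rw [← one_mul x, hr, ← hk, Algebra.smul_def, one_mul]⟩

theorem mulLeftRight_surjective [IsSimpleRing D] [Algebra.IsCentral K D] [Module.Finite K D] :
    Function.Surjective (AlgHom.mulLeftRight K D) := by
  intro f
  have := isSimpleModule_tensorProduct_mulOpposite K D
  let F : Module.End (Module.End (D ⊗[K] Dᵐᵒᵖ) D) D :=
    { f with
      map_smul' := fun g x => by
        obtain ⟨k, hk⟩ := exists_forall_end_apply_eq_smul g
        simp [hk] }
  obtain ⟨s, hs⟩ := Module.Finite.fg_top (R := K) (M := D)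
  obtain ⟨r, hr⟩ := jacobson_density F s
  exact ⟨r, LinearMap.ext_on hs fun y hy => (hr y hy).symm⟩

end CentralSimple

section CentralElements

open scoped TensorProduct nonZeroDivisors

section Localization

variable {C B D : Type*} [CommRing C] [IsDomain C] [Ring B] [Algebra C B] [Ring D] [Algebra C D]
  {ι : B →ₐ[C] D} [IsLocalizedModule C⁰ ι.toLinearMap]

variable (ι) in
theorem exists_smul_eq_of_isLocalizedModule (x : D) : ∃ (c : C) (b : B), c ≠ 0 ∧ c • x = ι b := by
  obtain ⟨⟨b, c⟩, h⟩ := IsLocalizedModule.surj C⁰ ι.toLinearMap x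
  exact ⟨c, b, nonZeroDivisors.ne_zero c.2, h⟩

theorem smul_injective_of_isLocalizedModule (ι : B →ₐ[C] D) [IsLocalizedModule C⁰ ι.toLinearMap]
    {c : C} (hc : c ≠ 0) : Function.Injective fun x : D => c • x :=
  IsLocalizedModule.smul_injective ι.toLinearMap ⟨c, mem_nonZeroDivisors_of_ne_zero hc⟩

variable {K : Type*} [Field K] [Algebra K D]

theorem exists_smul_mulLeftRight_eq (r : D ⊗[K] Dᵐᵒᵖ) : ∃ s : C, s ≠ 0 ∧ ∀ b : B, ∃ z : B,
    (∀ (J : Ideal B) [J.IsTwoSided], b ∈ J → z ∈ J) ∧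
      s • AlgHom.mulLeftRight K D r (ι b) = ι z := by
  induction r using TensorProduct.induction_on with
  | zero => exact ⟨1, one_ne_zero, fun b => ⟨0, fun J _ _ => J.zero_mem, by simp⟩⟩
  | tmul x y =>
    obtain ⟨c, u, hc, hu⟩ := exists_smul_eq_of_isLocalizedModule ι x
    obtain ⟨c', v, hc', hv⟩ := exists_smul_eq_of_isLocalizedModule ι y.unop
    refine ⟨c * c', mul_ne_zero hc hc', fun b => ⟨u * b * v, fun J _ hb =>
      J.mul_mem_right _ (J.mul_mem_left _ hb), ?_⟩⟩
    rw [AlgHom.mulLeftRight_apply, map_mul, map_mul, ← hu, ← hv, mul_smul, smul_mul_assoc,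
      smul_mul_assoc, mul_smul_comm]
  | add r r' h h' =>
    obtain ⟨s, hs, hz⟩ := h
    obtain ⟨s', hs', hz'⟩ := h'
    refine ⟨s * s', mul_ne_zero hs hs', fun b => ?_⟩
    obtain ⟨z, hzJ, hzb⟩ := hz b
    obtain ⟨z', hzJ', hzb'⟩ := hz' b
    refine ⟨s' • z + s • z', fun J _ hb => ?_, ?_⟩
    · exact J.add_mem (Submodule.smul_of_tower_mem J _ (hzJ J hb))
        (Submodule.smul_of_tower_mem J _ (hzJ' J hb))
    · rw [map_add, LinearMap.add_apply, smul_add, map_add, map_smul, map_smul, ← hzb, ← hzb',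
        smul_smul, smul_smul, mul_comm s s']

theorem IsPrimeRing.of_isLocalizedModule (hB : IsPrimeRing B) (hι : Function.Injective ι) :
    IsPrimeRing D := by
  intro x y h
  obtain ⟨c, b, hc, hb⟩ := exists_smul_eq_of_isLocalizedModule ι x
  obtain ⟨c', b', hc', hb'⟩ := exists_smul_eq_of_isLocalizedModule ι y
  refine (hB b b' fun z => hι ?_).imp
    (fun h => smul_injective_of_isLocalizedModule ι hc ?_)
    (fun h => smul_injective_of_isLocalizedModule ι hc' ?_)
  · rw [map_mul, map_mul, ← hb, ← hb', map_zero, smul_mul_assoc, smul_mul_assoc,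
      mul_smul_comm, h, smul_zero, smul_zero]
  · simp [hb, h]
  · simp [hb', h]

variable [Algebra.IsCentral C B]

theorem isCentral_of_isLocalizedModule [Algebra C K] [IsFractionRing C K] [IsScalarTower C K D]
    (hι : Function.Injective ι) : Algebra.IsCentral K D where
  out z hz := by
    obtain ⟨c, b, hc, hb⟩ := exists_smul_eq_of_isLocalizedModule ι z
    obtain ⟨k, rfl⟩ := mem_range_algebraMap_of_forall_mul_comm C (z := b) fun x => hι (by
      rw [map_mul, map_mul, ← hb, smul_mul_assoc, ← Subalgebra.mem_center_iff.1 hz,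
        mul_smul_comm])
    have hcK : algebraMap C K c ≠ 0 := (map_ne_zero_iff _ (IsFractionRing.injective C K)).2 hc
    refine Algebra.mem_bot.2 ⟨algebraMap C K k / algebraMap C K c,
      smul_injective_of_isLocalizedModule ι hc ?_⟩
    simp only [hb, AlgHom.commutes]
    rw [← algebraMap_smul K c, Algebra.smul_def, ← map_mul, mul_div_cancel₀ _ hcK,
      ← IsScalarTower.algebraMap_apply]

theorem exists_smul_smulRight_eq (hι : Function.Injective ι)
    (hf : Function.Surjective (AlgHom.mulLeftRight K D)) (f : D →ₗ[K] K) (e : D) : ∃ s : C, s ≠ 0 ∧ ∀ (J : Ideal B) [J.IsTwoSided], ∀ b ∈ J,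
      ∃ w ∈ (J.comap (algebraMap C B)).map (algebraMap C B), s • f.smulRight e (ι b) = ι w := by
  obtain ⟨r, hr⟩ := hf (Algebra.linearMap K D ∘ₗ f)
  obtain ⟨s, hs, hz⟩ := exists_smul_mulLeftRight_eq (ι := ι) r
  obtain ⟨c, β, hc, hβ⟩ := exists_smul_eq_of_isLocalizedModule ι e
  refine ⟨s * c, mul_ne_zero hs hc, fun J _ b hb => ?_⟩
  obtain ⟨z, hzJ, hzb⟩ := hz b
  rw [hr, LinearMap.comp_apply, Algebra.linearMap_apply] at hzb
  obtain ⟨k, rfl⟩ := mem_range_algebraMap_of_forall_mul_comm C (z := z) fun x => hι (by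
    rw [map_mul, map_mul, ← hzb, smul_mul_assoc, Algebra.commutes, mul_smul_comm])
  refine ⟨β * algebraMap C B k, Ideal.mul_mem_left _ _ (Ideal.mem_map_of_mem _ (hzJ J hb)), ?_⟩
  rw [← Algebra.commutes, map_mul, ← hzb, ← hβ, LinearMap.smulRight_apply, mul_smul,
    smul_mul_smul_comm, smul_smul, Algebra.smul_def (f (ι b))]

theorem exists_smul_mem_map_comap_of_surjective [Module.Finite K D] (hι : Function.Injective ι)
    (hf : Function.Surjective (AlgHom.mulLeftRight K D)) :
    ∃ s : C, s ≠ 0 ∧ ∀ (J : Ideal B) [J.IsTwoSided], ∀ b ∈ J,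
      s • b ∈ (J.comap (algebraMap C B)).map (algebraMap C B) := by
  let T (f : D →ₗ[K] D) : Prop := ∃ s : C, s ≠ 0 ∧ ∀ (J : Ideal B) [J.IsTwoSided], ∀ b ∈ J,
    ∃ w ∈ (J.comap (algebraMap C B)).map (algebraMap C B), s • f (ι b) = ι w
  have hadd : ∀ f g, T f → T g → T (f + g) := by
    rintro f g ⟨s, hs, hf⟩ ⟨s', hs', hg⟩
    refine ⟨s * s', mul_ne_zero hs hs', fun J _ b hb => ?_⟩
    obtain ⟨w, hw, hwb⟩ := hf J b hb
    obtain ⟨w', hw', hwb'⟩ := hg J b hb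
    refine ⟨s' • w + s • w', Submodule.add_mem _ (Submodule.smul_of_tower_mem _ _ hw)
      (Submodule.smul_of_tower_mem _ _ hw'), ?_⟩
    rw [map_add, map_smul, map_smul, ← hwb, ← hwb', LinearMap.add_apply, smul_add, smul_smul,
      smul_smul, mul_comm s s']
  have hzero : T 0 := ⟨1, one_ne_zero, fun J _ b _ => ⟨0, Submodule.zero_mem _, by simp⟩⟩
  let e := Module.finBasis K D
  have hid : ∑ i, (e.coord i).smulRight (e i) = LinearMap.id :=
    LinearMap.ext fun x => by simp [e.sum_repr]
  obtain ⟨s, hs, hs'⟩ : T LinearMap.id := hid ▸ Finset.sum_induction _ T hadd hzero fun i _ =>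
    exists_smul_smulRight_eq hι hf (e.coord i) (e i)
  refine ⟨s, hs, fun J _ b hb => ?_⟩
  obtain ⟨w, hw, hwb⟩ := hs' J b hb
  rw [LinearMap.id_apply, ← map_smul] at hwb
  rwa [hι hwb]

end Localization

variable {C B : Type*} [CommRing C] [Ring B] [Algebra C B]

theorem IsPrimeRing.exists_smul_mem_map_comap [IsDomain C] [Nontrivial B] [Module.Finite C B]
    [FaithfulSMul C B] [Algebra.IsCentral C B] (hB : IsPrimeRing B) :
    ∃ s : C, s ≠ 0 ∧ ∀ (J : Ideal B) [J.IsTwoSided], ∀ b ∈ J,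
      s • b ∈ (J.comap (algebraMap C B)).map (algebraMap C B) := by
  let K := FractionRing C
  let ι : B →ₐ[C] K ⊗[C] B := Algebra.TensorProduct.includeRight
  have hloc : IsLocalizedModule C⁰ ι.toLinearMap :=
    inferInstanceAs (IsLocalizedModule C⁰ (TensorProduct.mk C K B 1))
  have hι : Function.Injective ι := by
    refine (injective_iff_map_eq_zero ι).2 fun b hb => ?_
    obtain ⟨c, hc⟩ := (IsLocalizedModule.eq_zero_iff C⁰ ι.toLinearMap).1 hb
    exact (hB.eq_zero_or_eq_zero_of_smul_eq_zero hc).resolve_left (nonZeroDivisors.ne_zero c.2)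
  have : Nontrivial (K ⊗[C] B) := hι.nontrivial
  have : IsArtinianRing (K ⊗[C] B) := isArtinian_of_tower K inferInstance
  have : IsSimpleRing (K ⊗[C] B) := (hB.of_isLocalizedModule hι).isSimpleRing
  have : Algebra.IsCentral K (K ⊗[C] B) := isCentral_of_isLocalizedModule hι
  exact exists_smul_mem_map_comap_of_surjective hι (mulLeftRight_surjective K (K ⊗[C] B))

theorem smul_mem_smul_restrictScalars_of_le_mul {I J : Ideal B} (hIJ : J ≤ I * J) {s : C}
    (hs : ∀ b ∈ I, s • b ∈ (I.comap (algebraMap C B)).map (algebraMap C B)) {b : B} (hb : b ∈ J) :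
    s • b ∈ I.comap (algebraMap C B) • J.restrictScalars C := by
  refine Submodule.mul_induction_on (hIJ hb) (fun u hu v hv => ?_) fun x y hx hy => ?_
  · rw [← smul_mul_assoc]
    have hs' := hs u hu
    generalize s • u = t at hs'
    induction hs' using Submodule.span_induction with
    | mem x hx =>
      obtain ⟨z, hz, rfl⟩ := hx
      rw [← Algebra.smul_def]
      exact Submodule.smul_mem_smul hz hv
    | zero => rw [zero_mul]; exact Submodule.zero_mem _
    | add x y _ _ hx hy => rw [add_mul]; exact Submodule.add_mem _ hx hy
    | smul a x _ hx =>
      have hmap : (I.comap (algebraMap C B) • J.restrictScalars C).map (LinearMap.mulLeft C a) ≤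
          I.comap (algebraMap C B) • J.restrictScalars C := by
        rw [Submodule.map_smul'']
        refine Submodule.smul_mono le_rfl ?_
        rintro _ ⟨y, hy, rfl⟩
        exact J.mul_mem_left a hy
      rw [smul_eq_mul, mul_assoc]
      exact hmap ⟨_, hx, rfl⟩
  · rw [smul_add]; exact Submodule.add_mem _ hx hy

theorem exists_pow_add_smul_eq_zero {V : Type*} [AddCommGroup V] [Module C V] {N : Submodule C V}
    (hN : N.FG) {𝔡 : Ideal C} {s : C} (hs : ∀ v ∈ N, s • v ∈ 𝔡 • N) :
    ∃ n : ℕ, ∃ d ∈ 𝔡, ∀ v ∈ N, (s ^ n + d) • v = 0 := by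
  have := Module.Finite.iff_fg.2 hN
  have hrange : LinearMap.range (algebraMap C (Module.End C N) s) ≤ 𝔡 • ⊤ := by
    rintro _ ⟨v, rfl⟩
    have hv : s • v.1 ∈ Submodule.map N.subtype (𝔡 • ⊤) := by
      rw [Submodule.map_smul'', Submodule.map_top, Submodule.range_subtype]
      exact hs v v.2
    obtain ⟨z, hz, hzv⟩ := hv
    rwa [Module.algebraMap_end_apply, ← (Subtype.ext hzv : z = s • v)]
  obtain ⟨p, hp, -, hpc, hp0⟩ :=
    LinearMap.exists_monic_and_natDegree_eq_and_coeff_mem_pow_and_aeval_eq_zero C _ 𝔡 hrange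
  refine ⟨p.natDegree, ∑ k ∈ Finset.range p.natDegree, p.coeff k * s ^ k,
    Ideal.sum_mem _ fun k hk => 𝔡.mul_mem_right _ ?_, fun v hv => ?_⟩
  · exact Ideal.pow_le_self (Nat.sub_ne_zero_of_lt (Finset.mem_range.1 hk)) (hpc k)
  · rw [Polynomial.aeval_algebraMap_apply_eq_algebraMap_eval, Polynomial.eval_eq_sum_range,
      Finset.sum_range_succ, hp.coeff_natDegree, one_mul, add_comm] at hp0
    exact congrArg Subtype.val (LinearMap.congr_fun hp0 ⟨v, hv⟩)

theorem IsPrimeRing.exists_pow_mem_of_le_mul [IsNoetherianRing C] [Module.Finite C B]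
    [FaithfulSMul C B] (hB : IsPrimeRing B) {I J : Ideal B} (hJ : J ≠ ⊥) (hIJ : J ≤ I * J) {s : C}
    (hs : ∀ b ∈ I, s • b ∈ (I.comap (algebraMap C B)).map (algebraMap C B)) :
    ∃ n : ℕ, algebraMap C B s ^ n ∈ I := by
  have : IsNoetherian C B := isNoetherian_of_isNoetherianRing_of_finite C B
  obtain ⟨n, d, hd, hzero⟩ := exists_pow_add_smul_eq_zero
    (IsNoetherian.noetherian (J.restrictScalars C))
    fun _ => smul_mem_smul_restrictScalars_of_le_mul hIJ hs
  obtain ⟨b, hb, hb0⟩ := (Submodule.ne_bot_iff J).1 hJ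
  have hsum := (hB.eq_zero_or_eq_zero_of_smul_eq_zero (hzero b hb)).resolve_right hb0
  refine ⟨n, ?_⟩
  rw [← map_pow, eq_neg_of_add_eq_zero_left hsum, map_neg]
  exact I.neg_mem hd

end CentralElements

section Chains

theorem IsPrimeRing.isDomain_of_faithfulSMul (C : Type*) {B : Type*} [CommRing C] [Ring B]
    [Nontrivial B] [Algebra C B] [FaithfulSMul C B] (hB : IsPrimeRing B) : IsDomain C := by
  have := (algebraMap C B).domain_nontrivial
  have : NoZeroDivisors C := ⟨fun {a b} hab =>
    (hB.eq_zero_or_eq_zero_of_smul_eq_zero (c := a) (b := algebraMap C B b)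
      (by rw [Algebra.smul_def, ← map_mul, hab, map_zero])).imp id
      fun h => (FaithfulSMul.algebraMap_eq_zero_iff C B).1 h⟩
  exact NoZeroDivisors.to_isDomain C

instance isCentral_center (B : Type*) [Ring B] : Algebra.IsCentral (Subring.center B) B where
  out z hz := Algebra.mem_bot.2
    ⟨⟨z, Subring.mem_center_iff.2 (Subalgebra.mem_center_iff.1 hz)⟩, rfl⟩

theorem isTwoSided_sup {B : Type*} [Ring B] (I J : Ideal B) [I.IsTwoSided] [J.IsTwoSided] :
    (I ⊔ J).IsTwoSided where
  mul_mem_of_left b h := by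
    obtain ⟨x, hx, y, hy, rfl⟩ := Submodule.mem_sup.1 h
    rw [add_mul]
    exact Submodule.add_mem_sup (I.mul_mem_right b hx) (J.mul_mem_right b hy)

theorem isTwoSided_span_singleton_of_commute {B : Type*} [Ring B] {s : B}
    (hs : ∀ x, Commute s x) : (Ideal.span {s}).IsTwoSided where
  mul_mem_of_left {a} b ha := by
    obtain ⟨y, rfl⟩ := Ideal.mem_span_singleton'.1 ha
    exact Ideal.mem_span_singleton'.2 ⟨y * b, by rw [mul_assoc, mul_assoc, (hs b).eq]⟩

theorem IsPrimeRing.exists_ideal_pow_le (R : Type*) {B : Type*} [CommRing R] [IsNoetherianRing R]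
    [Ring B] [Algebra R B] [Module.Finite R B] [Nontrivial B] (hB : IsPrimeRing B) :
    ∃ S : Ideal B, S.IsTwoSided ∧ S ≠ ⊥ ∧
      ∀ I J : Ideal B, I.IsTwoSided → J ≠ ⊥ → J ≤ I * J → ∃ n : ℕ, S ^ n ≤ I := by
  let C := Subring.center B
  let _ : Algebra R C := ((algebraMap R B).codRestrict C fun r =>
    Subring.mem_center_iff.2 fun x => (Algebra.commutes r x).symm).toAlgebra
  have : IsScalarTower R C B := IsScalarTower.of_algebraMap_eq fun _ => rfl
  have : IsDomain C := hB.isDomain_of_faithfulSMul C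
  have : IsNoetherian R B := isNoetherian_of_isNoetherianRing_of_finite R B
  have : IsNoetherianRing C := isNoetherian_of_tower R
    (isNoetherian_of_injective (IsScalarTower.toAlgHom R C B).toLinearMap Subtype.val_injective)
  have : Module.Finite C B := Module.Finite.of_restrictScalars_finite R C B
  obtain ⟨s, hs0, hs⟩ := hB.exists_smul_mem_map_comap (C := C)
  have := isTwoSided_span_singleton_of_commute fun x : B => Algebra.commutes s x
  refine ⟨Ideal.span {algebraMap C B s}, this, ?_, fun I J hI hJ hIJ => ?_⟩
  · rwa [Ne, Ideal.span_singleton_eq_bot, FaithfulSMul.algebraMap_eq_zero_iff]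
  · obtain ⟨n, hn⟩ := hB.exists_pow_mem_of_le_mul hJ hIJ (hs I)
    refine ⟨n, ?_⟩
    rwa [Ideal.span_singleton_pow, Ideal.span_singleton_le_iff_mem]

theorem le_of_le_mul_of_le_sup_of_pow_le {B : Type*} [Ring B] {I J K S : Ideal B} [J.IsTwoSided]
    {n : ℕ} (hI : I ≤ K * I) (hK : K ≤ J ⊔ S) (hS : S ^ n ≤ J) : I ≤ J := by
  have step : I ≤ J ⊔ S * I :=
    calc I ≤ (J ⊔ S) * I := hI.trans (Ideal.mul_mono_left hK)
      _ = J * I ⊔ S * I := Ideal.sup_mul J S I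
      _ ≤ J ⊔ S * I := sup_le_sup_right Ideal.mul_le_left _
  have iterate (m : ℕ) : I ≤ J ⊔ S ^ m * I := by
    induction m with
    | zero => rw [Submodule.pow_zero, Ideal.one_eq_top, Ideal.top_mul]; exact le_sup_right
    | succ m ih =>
      calc I ≤ J ⊔ S ^ m * (J ⊔ S * I) := ih.trans (sup_le_sup_left (Ideal.mul_mono_right step) J)
        _ = J ⊔ S ^ m * J ⊔ S ^ (m + 1) * I := by
          rw [Ideal.mul_sup, sup_assoc, Submodule.pow_succ, Ideal.mul_assoc]
        _ = J ⊔ S ^ (m + 1) * I := by rw [sup_eq_left.2 (Ideal.mul_le_right (J := J))]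
  exact (iterate n).trans (sup_le le_rfl ((Ideal.mul_mono_left hS).trans Ideal.mul_le_left))

theorem comap_mul_comap_le {A B : Type*} [Ring A] [Ring B] (f : A →+* B) (I J : Ideal B) :
    I.comap f * J.comap f ≤ (I * J).comap f := Ideal.mul_le.2 fun r hr s hs => by
  rw [Ideal.mem_comap, map_mul]
  exact Ideal.mul_mem_mul hr hs

theorem map_mul_le {A B : Type*} [Ring A] [Ring B] (f : A →+* B) (I J : Ideal A) :
    (I * J).map f ≤ I.map f * J.map f :=
  Ideal.map_le_iff_le_comap.2
    ((Ideal.mul_mono Ideal.le_comap_map Ideal.le_comap_map).trans (comap_mul_comap_le f _ _))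

theorem comap_pow_le {A B : Type*} [Ring A] [Ring B] (f : A →+* B) (I : Ideal B) (n : ℕ) :
    I.comap f ^ n ≤ (I ^ n).comap f := by
  induction n with
  | zero => rw [Submodule.pow_zero, Submodule.pow_zero, Ideal.one_eq_top, Ideal.one_eq_top,
      Ideal.comap_top]
  | succ n ih =>
    rw [Submodule.pow_succ, Submodule.pow_succ]
    exact (Ideal.mul_mono_left ih).trans (comap_mul_comap_le f _ _)

theorem exists_lt_forall_pow_le_sup (R : Type*) {A : Type*} [CommRing R] [IsNoetherianRing R]
    [Ring A] [Algebra R A] [Module.Finite R A] {J : Ideal A} [J.IsTwoSided] (hJ : J ≠ ⊤)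
    (hprime : IsPrimeRing (A ⧸ J)) :
    ∃ H : Ideal A, J < H ∧ H.IsTwoSided ∧
      ∀ N L : Ideal A, N.IsTwoSided → L ≤ N * L → ¬ L ≤ J → ∃ n : ℕ, H ^ n ≤ N ⊔ J := by
  let π := Ideal.Quotient.mk J
  have hπ : Function.Surjective π := Ideal.Quotient.mk_surjective
  have : RingHomSurjective π := ⟨hπ⟩
  have comap_map (I : Ideal A) : (I.map π).comap π = I ⊔ J := by
    rw [Ideal.comap_map_of_surjective π hπ, ← RingHom.ker_eq_comap_bot, Ideal.mk_ker]
  have : Nontrivial (A ⧸ J) := Ideal.Quotient.nontrivial_iff.2 hJ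
  obtain ⟨S, hS, hS0, hpow⟩ := hprime.exists_ideal_pow_le R
  have map_comap : (S.comap π).map π = S := Ideal.map_comap_of_surjective π hπ S
  have hJS : J ≤ S.comap π :=
    Ideal.map_le_iff_le_comap.1 ((Ideal.map_quotient_self J).trans_le bot_le)
  refine ⟨S.comap π, lt_of_le_of_ne hJS fun h => hS0 ?_, inferInstance, fun N L hN hL hLJ => ?_⟩
  · rw [← map_comap, ← h, Ideal.map_quotient_self]
  · obtain ⟨n, hn⟩ := hpow (N.map π) (L.map π) inferInstance
      (fun h => hLJ (by rwa [Ideal.map_eq_bot_iff_le_ker, Ideal.mk_ker] at h))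
      ((Ideal.map_mono hL).trans (map_mul_le π N L))
    refine ⟨n, ?_⟩
    rw [← comap_map]
    exact (comap_pow_le π S n).trans (Ideal.comap_mono hn)

theorem exists_lt_lt_mul_le {A : Type*} [Ring A] {J : Ideal A} [J.IsTwoSided]
    (hJ : ¬ IsPrimeRing (A ⧸ J)) :
    ∃ J₁ J₂ : Ideal A, J < J₁ ∧ J < J₂ ∧ J₁.IsTwoSided ∧ J₂.IsTwoSided ∧ J₁ * J₂ ≤ J := by
  simp only [IsPrimeRing, Ideal.Quotient.mk_surjective.forall, ← map_mul,
    Ideal.Quotient.eq_zero_iff_mem] at hJ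
  push Not at hJ
  obtain ⟨a, b, hab, ha, hb⟩ := hJ
  have lt_sup {c : A} (hc : c ∉ J) : J < J ⊔ Ideal.span {c} * ⊤ := by
    refine lt_of_le_of_ne le_sup_left fun h => hc ?_
    rw [h]
    have hc : c * 1 ∈ Ideal.span {c} * ⊤ :=
      Ideal.mul_mem_mul (Ideal.mem_span_singleton_self c) Submodule.mem_top
    rw [mul_one] at hc
    exact Submodule.mem_sup_right hc
  have hmul : Ideal.span {a} * Ideal.span {b} ≤ J := Ideal.mul_le.2 fun x hx y hy => by
    obtain ⟨r, rfl⟩ := Ideal.mem_span_singleton'.1 hx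
    obtain ⟨c, rfl⟩ := Ideal.mem_span_singleton'.1 hy
    rw [mul_assoc, ← mul_assoc a]
    exact J.mul_mem_left r (hab c)
  refine ⟨_, _, lt_sup ha, lt_sup hb, isTwoSided_sup _ _, isTwoSided_sup _ _, ?_⟩
  rw [Ideal.sup_mul, Ideal.mul_sup (Ideal.span {a} * ⊤)]
  refine sup_le Ideal.mul_le_left (sup_le Ideal.mul_le_right ?_)
  rw [Ideal.mul_assoc, ← Ideal.mul_assoc (I := ⊤), Ideal.top_mul, ← Ideal.mul_assoc]
  exact (Ideal.mul_mono_left hmul).trans Ideal.mul_le_left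

theorem exists_forall_le_sup (R : Type*) {A : Type*} [CommRing R] [IsNoetherianRing R] [Ring A]
    [Algebra R A] [Module.Finite R A] (I : ℕ → Ideal A) (hI : ∀ k, (I k).IsTwoSided)
    (hmul : ∀ k, I (k + 1) ≤ I k * I (k + 1)) (J : Ideal A) (hJ : J.IsTwoSided) :
    ∃ k, ∀ m, I k ≤ I m ⊔ J := by
  have hanti : Antitone I := antitone_nat_of_succ_le fun k => (hmul k).trans Ideal.mul_le_left
  have : IsNoetherianRing A := IsNoetherianRing.of_finite R A
  induction J using WellFoundedGT.induction with
  | ind J ih =>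
  by_cases htop : J = ⊤
  · exact ⟨0, fun m => htop ▸ le_top.trans le_sup_right⟩
  by_cases hprime : IsPrimeRing (A ⧸ J)
  · by_cases hsmall : ∃ k, I k ≤ J
    · exact hsmall.imp fun k hk m => hk.trans le_sup_right
    obtain ⟨H, hJH, hH, hpow⟩ := exists_lt_forall_pow_le_sup R htop hprime
    obtain ⟨k, hk⟩ := ih H hJH hH
    refine ⟨k + 1, fun m => ?_⟩
    obtain ⟨n, hn⟩ := hpow _ _ (hI m) (hmul m) fun h => hsmall ⟨m + 1, h⟩
    have := isTwoSided_sup (I m) J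
    exact le_of_le_mul_of_le_sup_of_pow_le (hmul k)
      ((hk m).trans (sup_le_sup_right le_sup_left H)) hn
  · obtain ⟨J₁, J₂, h₁, h₂, hJ₁, hJ₂, hJ₁₂⟩ := exists_lt_lt_mul_le hprime
    obtain ⟨k₁, hk₁⟩ := ih J₁ h₁ hJ₁
    obtain ⟨k₂, hk₂⟩ := ih J₂ h₂ hJ₂
    refine ⟨max k₁ k₂ + 1, fun m => ?_⟩
    calc I (max k₁ k₂ + 1) ≤ I (max k₁ k₂) * I (max k₁ k₂ + 1) := hmul _
      _ ≤ (I m ⊔ J₁) * (I m ⊔ J₂) := Ideal.mul_mono ((hanti (le_max_left _ _)).trans (hk₁ m))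
          ((hanti ((le_max_right _ _).trans (Nat.le_succ _))).trans (hk₂ m))
      _ = I m * (I m ⊔ J₂) ⊔ (J₁ * I m ⊔ J₁ * J₂) := by rw [Ideal.sup_mul, Ideal.mul_sup J₁]
      _ ≤ I m ⊔ J := sup_le (Ideal.mul_le_left.trans le_sup_left)
          (sup_le_sup Ideal.mul_le_right hJ₁₂)

end Chains

section FairSize

variable {A : Type u} [Ring A] {P : Type u} [AddCommGroup P] [Module A P]

theorem exists_traceOf_quotient_le_mul [hP : Module.Projective A P] {X : Submodule A P}
    (hX : X.FG) :
    ∃ Y : Submodule A P, Y.FG ∧ X ≤ Y ∧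
      traceOf A (P ⧸ Y) ≤ traceOf A (P ⧸ X) * traceOf A (P ⧸ Y) ∧
      Y ⊔ traceOf A (P ⧸ X) • ⊤ = ⊤ := by
  classical
  obtain ⟨s, hs⟩ := Module.projective_def'.1 hP
  have sum_smul (p : P) : ∑ q ∈ (s p).support, s p q • q = p := LinearMap.congr_fun hs p
  obtain ⟨t, rfl⟩ := hX
  -- The coordinates outside `S` vanish on `X`, so their values lie in the trace of `P ⧸ X`.
  let S : Finset P := t.biUnion fun x => (s x).support
  have coord_mem {q : P} (hq : q ∉ S) (p : P) :
      s p q ∈ traceOf A (P ⧸ Submodule.span A (t : Set P)) := by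
    refine traceOf_quotient_le_iff.1 le_rfl (Finsupp.lapply q ∘ₗ s)
      (Submodule.span_le.2 fun x hx => ?_) p
    by_contra hxq
    exact hq (Finset.mem_biUnion.2 ⟨x, hx, Finsupp.mem_support_iff.2 hxq⟩)
  have mem_sup {q : P} (hq : q ∈ S) : q ∈ Submodule.span A (t : Set P) ⊔ Submodule.span A S :=
    Submodule.mem_sup_right (Submodule.subset_span hq)
  refine ⟨Submodule.span A t ⊔ Submodule.span A S, Submodule.FG.sup ⟨t, rfl⟩ ⟨S, rfl⟩,
    le_sup_left, traceOf_quotient_le_iff.2 fun g hg p => ?_, eq_top_iff.2 fun p _ => ?_⟩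
  · rw [← sum_smul p, map_sum]
    refine Submodule.sum_mem _ fun q _ => ?_
    rw [map_smul]
    by_cases hq : q ∈ S
    · rw [LinearMap.mem_ker.1 (hg (mem_sup hq)), smul_zero]
      exact Submodule.zero_mem _
    · exact Ideal.mul_mem_mul (coord_mem hq p) (traceOf_quotient_le_iff.1 le_rfl g hg q)
  · rw [← sum_smul p]
    refine Submodule.sum_mem _ fun q _ => ?_
    by_cases hq : q ∈ S
    · exact Submodule.mem_sup_left (Submodule.smul_mem _ _ (mem_sup hq))
    · exact Submodule.mem_sup_right (Submodule.smul_mem_smul (coord_mem hq p) Submodule.mem_top)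

theorem exists_seq_traceOf_quotient_le_mul [Module.Projective A P] (hP : IsCountablyGen A P) :
    ∃ X : ℕ → Submodule A P, (∀ n, (X n).FG) ∧ Monotone X ∧ (∀ p, ∃ n, p ∈ X n) ∧
      (∀ n, traceOf A (P ⧸ X (n + 1)) ≤ traceOf A (P ⧸ X n) * traceOf A (P ⧸ X (n + 1))) ∧
      ∀ n, X (n + 1) ⊔ traceOf A (P ⧸ X n) • ⊤ = ⊤ := by
  obtain ⟨Z, -, hZ, mem_Z⟩ := hP.exists_monotone_fg
  have step (n : ℕ) (X : {X : Submodule A P // X.FG}) : ∃ Y : {X : Submodule A P // X.FG},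
      X.1 ⊔ Z n ≤ Y.1 ∧ traceOf A (P ⧸ Y.1) ≤ traceOf A (P ⧸ X.1) * traceOf A (P ⧸ Y.1) ∧
      Y.1 ⊔ traceOf A (P ⧸ X.1) • ⊤ = ⊤ := by
    obtain ⟨Y, hY, hXY, hmul, htop⟩ := exists_traceOf_quotient_le_mul (X.2.sup (hZ n))
    have hle : traceOf A (P ⧸ X.1 ⊔ Z n) ≤ traceOf A (P ⧸ X.1) :=
      traceOf_quotient_antitone le_sup_left
    exact ⟨⟨Y, hY⟩, hXY, hmul.trans (Ideal.mul_mono_left hle),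
      eq_top_iff.2 (htop.ge.trans (sup_le_sup_left (Submodule.smul_mono hle le_rfl) _))⟩
  choose next hle hmul htop using step
  let X (n : ℕ) : {X : Submodule A P // X.FG} := Nat.rec ⟨⊥, Submodule.fg_bot⟩ next n
  refine ⟨fun n => (X n).1, fun n => (X n).2,
    monotone_nat_of_le_succ fun n => le_sup_left.trans (hle n (X n)), fun p => ?_,
    fun n => hmul n (X n), fun n => htop n (X n)⟩
  obtain ⟨n, hn⟩ := mem_Z p
  exact ⟨n + 1, hle n (X n) (Submodule.mem_sup_right hn)⟩

theorem exists_idempotent_le_traceOf_quotient (R : Type v) [CommRing R] [IsNoetherianRing R]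
    [Algebra R A] [Module.Finite R A] [Module.Projective A P] (hP : IsCountablyGen A P) :
    ∃ I : Ideal A, I.IsTwoSided ∧ I * I = I ∧
      (∀ X : Submodule A P, X.FG → I ≤ traceOf A (P ⧸ X)) ∧
      ∃ X : Submodule A P, X.FG ∧ X ⊔ I • ⊤ = ⊤ := by
  obtain ⟨X, hX, hmono, mem_X, hmul, htop⟩ := exists_seq_traceOf_quotient_le_mul hP
  obtain ⟨k, hk⟩ := exists_forall_le_sup R (fun n => traceOf A (P ⧸ X n))
    (fun _ => inferInstance) hmul ⊥ inferInstance
  simp only [sup_bot_eq] at hk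
  refine ⟨traceOf A (P ⧸ X k), inferInstance, le_antisymm Ideal.mul_le_right ?_, ?_,
    X (k + 1), hX (k + 1), htop k⟩
  · exact (hk (k + 1)).trans ((hmul k).trans
      (Ideal.mul_mono_right (traceOf_quotient_antitone (hmono k.le_succ))))
  · rintro _ ⟨t, rfl⟩
    choose N hN using mem_X
    have hle : Submodule.span A (t : Set P) ≤ X (t.sup N) :=
      Submodule.span_le.2 fun x hx => hmono (Finset.le_sup hx) (hN x)
    exact (hk _).trans (traceOf_quotient_antitone hle)

theorem exists_right_generators (R : Type v) [CommRing R] [IsNoetherianRing R] [Algebra R A]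
    [Module.Finite R A] (I : Ideal A) :
    ∃ (m : ℕ) (x : Fin m → A), (∀ j, x j ∈ I) ∧
      ∀ a ∈ I, ∃ c : Fin m → A, a = ∑ j, x j * c j := by
  have : IsNoetherian R A := isNoetherian_of_isNoetherianRing_of_finite R A
  obtain ⟨m, x, hx⟩ := Submodule.fg_iff_exists_fin_generating_family.1
    (IsNoetherian.noetherian (I.restrictScalars R))
  have mem_iff (a : A) : a ∈ I ↔ a ∈ Submodule.span R (Set.range x) := by
    rw [hx, Submodule.restrictScalars_mem]
  refine ⟨m, x, fun j => (mem_iff _).2 (Submodule.subset_span ⟨j, rfl⟩), fun a ha => ?_⟩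
  obtain ⟨c, rfl⟩ := (Submodule.mem_span_range_iff_exists_fun R).1 ((mem_iff a).1 ha)
  exact ⟨fun j => algebraMap R A (c j), Finset.sum_congr rfl fun j _ => by
    rw [Algebra.smul_def, Algebra.commutes]⟩

theorem exists_traceOf_eq (R : Type v) [CommRing R] [IsNoetherianRing R] [Algebra R A]
    [Module.Finite R A] {I : Ideal A} [I.IsTwoSided] (hI : I * I = I) :
    ∃ W : ModuleCat.{u} A, IsCountablyGen A W ∧ Module.Projective A W ∧ traceOf A W = I := by
  obtain ⟨m, x, hxI, hx⟩ := exists_right_generators R I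
  obtain ⟨W, hW, hWproj, ⟨e⟩, hle⟩ := exists_projective_lift (ι := Unit) hI hxI hx
    (Q := PUnit) ⟨0, 0, LinearMap.ext fun _ => rfl⟩
  have htop : I • (⊤ : Submodule A W) = ⊤ :=
    Submodule.Quotient.subsingleton_iff.1 e.toEquiv.subsingleton
  exact ⟨W, hW, hWproj, le_antisymm (traceOf_le_of_smul_top htop) (hle ⟨()⟩)⟩

theorem exists_isBig (R : Type v) [CommRing R] [IsNoetherianRing R] [Algebra R A]
    [Module.Finite R A] [Module.Projective A P] (hP : IsCountablyGen A P) :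
    ∃ I : TraceIdeals A, IsBig I.ideal P ∧ ∃ X : Submodule A P, X.FG ∧ X ⊔ I.ideal • ⊤ = ⊤ := by
  have : IsNoetherianRing A := IsNoetherianRing.of_finite R A
  obtain ⟨I, hI, hII, hIP, hfg⟩ := exists_idempotent_le_traceOf_quotient R hP
  exact ⟨⟨I, exists_traceOf_eq R hII⟩, IsBig.of_le_traceOf_quotient hP hIP, hfg⟩

end FairSize

section Quotients

section

variable {A : Type v} [Ring A] {I : Ideal A} [I.IsTwoSided] {N L : Type u}
  [AddCommGroup N] [Module A N] [Module (A ⧸ I) N] [IsScalarTower A (A ⧸ I) N]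

theorem quotient_mk_smul (a : A) (x : N) : Ideal.Quotient.mk I a • x = a • x := by
  have hmk : Ideal.Quotient.mk I a = a • (1 : A ⧸ I) := congrArg _ (mul_one a).symm
  rw [hmk, smul_assoc, one_smul]

variable [AddCommGroup L] [Module A L] [Module (A ⧸ I) L] [IsScalarTower A (A ⧸ I) L]

instance compatibleSMul_quotient : LinearMap.CompatibleSMul N L (A ⧸ I) A where
  map_smul f c x := by
    obtain ⟨a, rfl⟩ := Ideal.Quotient.mk_surjective c
    rw [quotient_mk_smul, quotient_mk_smul, map_smul]

theorem isSummand_quotient_iff : IsSummand (A ⧸ I) N L ↔ IsSummand A N L :=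
  ⟨fun ⟨i, p, h⟩ => ⟨i.restrictScalars A, p.restrictScalars A,
      LinearMap.ext fun x => LinearMap.congr_fun h x⟩,
    fun ⟨i, p, h⟩ => ⟨i.restrictScalars (A ⧸ I), p.restrictScalars (A ⧸ I),
      LinearMap.ext fun x => LinearMap.congr_fun h x⟩⟩

end

variable {A : Type u} [Ring A] {I : Ideal A} {P L : Type u} [AddCommGroup P] [Module A P]
  [AddCommGroup L] [Module A L]

theorem nonempty_quotient_prod_equiv (hL : I • (⊤ : Submodule A L) = ⊤) :
    Nonempty (((P × L) ⧸ I • (⊤ : Submodule A (P × L))) ≃ₗ[A] P ⧸ I • (⊤ : Submodule A P)) := by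
  let f : P × L →ₗ[A] P ⧸ I • (⊤ : Submodule A P) := Submodule.mkQ _ ∘ₗ LinearMap.fst A P L
  have hf : Function.Surjective f := (Submodule.mkQ_surjective _).comp Prod.fst_surjective
  have hker : I • (⊤ : Submodule A (P × L)) = LinearMap.ker f := by
    ext z
    rw [LinearMap.mem_ker, LinearMap.comp_apply, Submodule.mkQ_apply,
      Submodule.Quotient.mk_eq_zero]
    exact ⟨map_mem_smul_top (LinearMap.fst A P L),
      fun hz => mem_smul_top_prod hz (hL.ge Submodule.mem_top)⟩
  exact ⟨(Submodule.quotEquivOfEq _ _ hker).trans (f.quotKerEquivOfSurjective hf)⟩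

variable [I.IsTwoSided]

theorem memFinAdd_quotient_iff [Module.Projective A P] :
    MemFinAdd (A ⧸ I) (A ⧸ I) (P ⧸ I • (⊤ : Submodule A P)) ↔
      ∃ X : Submodule A P, X.FG ∧ X ⊔ I • ⊤ = ⊤ := by
  constructor
  · rintro ⟨n, h⟩
    have : Module.Finite (A ⧸ I) (P ⧸ I • (⊤ : Submodule A P)) := h.finite
    obtain ⟨X, hX, hmap⟩ := exists_fg_map_eq (f := (I • (⊤ : Submodule A P)).mkQ)
      (Module.Finite.trans (A ⧸ I) (P ⧸ I • (⊤ : Submodule A P))).fg_top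
      (Submodule.range_mkQ _).ge
    exact ⟨X, hX, by rwa [sup_comm, ← Submodule.map_mkQ_eq_top]⟩
  · rintro ⟨X, hX, htop⟩
    have : Module.Finite A (P ⧸ I • (⊤ : Submodule A P)) :=
      ⟨(Submodule.map_mkQ_eq_top _ X).2 (by rwa [sup_comm]) ▸ hX.map _⟩
    have : Module.Finite (A ⧸ I) (P ⧸ I • (⊤ : Submodule A P)) :=
      Module.Finite.of_restrictScalars_finite A _ _
    obtain ⟨n, f, hf⟩ := Module.Finite.exists_fin' (A ⧸ I) (P ⧸ I • (⊤ : Submodule A P))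
    obtain ⟨g, hg⟩ := Module.projective_lifting_property (f.restrictScalars A)
      (I • (⊤ : Submodule A P)).mkQ hf
    have hgI : I • (⊤ : Submodule A P) ≤ LinearMap.ker g := Submodule.smul_le.2 fun a ha p _ => by
      rw [LinearMap.mem_ker, map_smul, ← quotient_mk_smul (I := I),
        Ideal.Quotient.eq_zero_iff_mem.2 ha, zero_smul]
    refine ⟨n, isSummand_quotient_iff.2 ⟨Submodule.liftQ _ g hgI, f.restrictScalars A, ?_⟩⟩
    exact Submodule.linearMap_qext _ hg

theorem exists_isBig_equiv (R : Type v) [CommRing R] [IsNoetherianRing R] [Algebra R A]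
    [Module.Finite R A] (I : TraceIdeals A) {ι : Type} [Finite ι] {Q : Type u} [AddCommGroup Q]
    [Module A Q] (hQ : IsSummand A Q (ι → A ⧸ I.ideal)) :
    ∃ P : ModuleCat.{u} A, IsCountablyGen A P ∧ Module.Projective A P ∧ IsBig I.ideal P ∧
      Nonempty ((P ⧸ I.ideal • (⊤ : Submodule A P)) ≃ₗ[A] Q) := by
  have : IsNoetherianRing A := IsNoetherianRing.of_finite R A
  obtain ⟨W, hW, hWproj, hWtrace : traceOf A W = I.ideal⟩ := I.2
  obtain ⟨m, x, hxI, hx⟩ := exists_right_generators R I.ideal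
  obtain ⟨L, hL, hLproj, ⟨e⟩, -⟩ :=
    exists_projective_lift (hWtrace ▸ traceOf_mul_self) hxI hx hQ
  obtain ⟨e'⟩ := nonempty_quotient_prod_equiv (P := L)
    (smul_top_finsupp (ι := ℕ) (hWtrace ▸ traceOf_smul_top : I.ideal • (⊤ : Submodule A W) = ⊤))
  have hcount : IsCountablyGen A (L × (ℕ →₀ W)) := hL.prod (hW.finsupp ℕ)
  refine ⟨ModuleCat.of A (L × (ℕ →₀ W)), hcount,
    inferInstanceAs (Module.Projective A (L × (ℕ →₀ W))), ?_, ⟨e'.trans e⟩⟩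
  exact IsBig.of_le_traceOf_quotient hcount fun X hX => hWtrace ▸
    traceOf_le_traceOf_quotient (f := LinearMap.snd A L (ℕ →₀ W)) LinearMap.snd_surjective hX

theorem exists_isBig_quotient_equiv (R : Type v) [CommRing R] [IsNoetherianRing R] [Algebra R A]
    [Module.Finite R A] (I : TraceIdeals A) {Q : Type u} [AddCommGroup Q]
    [Module (A ⧸ I.ideal) Q] (hQ : MemFinAdd (A ⧸ I.ideal) (A ⧸ I.ideal) Q) :
    ∃ P : ModuleCat.{u} A, IsCountablyGen A P ∧ Module.Projective A P ∧ IsBig I.ideal P ∧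
      Nonempty ((P ⧸ I.ideal • (⊤ : Submodule A P)) ≃ₗ[A ⧸ I.ideal] Q) := by
  obtain ⟨n, hQ⟩ := hQ
  let : Module A Q := Module.compHom Q (Ideal.Quotient.mk I.ideal)
  have : IsScalarTower A (A ⧸ I.ideal) Q := ⟨fun a c q => mul_smul (Ideal.Quotient.mk _ a) c q⟩
  obtain ⟨P, hP, hproj, hbig, ⟨e⟩⟩ := exists_isBig_equiv R I (isSummand_quotient_iff.1 hQ)
  exact ⟨P, hP, hproj, hbig, ⟨e.restrictScalars (A ⧸ I.ideal)⟩⟩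

end Quotients

section RegularModule

variable {A : Type v} [Ring A] {M N : Type u} [AddCommGroup M] [Module A M]
  [AddCommGroup N] [Module A N]

theorem MemFinAdd.memAdd (h : MemFinAdd A M N) : MemAdd A M N := by
  obtain ⟨n, h⟩ := h
  exact ⟨ULift (Fin n), h.trans (IsSummand.of_equiv
    ((Finsupp.linearEquivFunOnFinite A M (Fin n)).symm.trans
      (Finsupp.domLCongr Equiv.ulift.symm)))⟩

theorem MemFinAdd.isCountablyGen [Module.Finite A M] (h : MemFinAdd A M N) :
    IsCountablyGen A N := by
  obtain ⟨n, h⟩ := h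
  exact h.isCountablyGen IsCountablyGen.of_finite

theorem MemAdd.exists_countable (h : MemAdd A M N) (hN : IsCountablyGen A N) :
    ∃ ι : Type u, Countable ι ∧ IsSummand A N (ι →₀ M) := by
  classical
  obtain ⟨ι, i, p, hpi⟩ := h
  obtain ⟨s, hs, hspan⟩ := hN
  let J : Set ι := ⋃ x ∈ s, ((i x).support : Set ι)
  refine ⟨J, (hs.biUnion fun x _ => (i x).support.countable_toSet).to_subtype,
    Finsupp.lsubtypeDomain J ∘ₗ i, p ∘ₗ Finsupp.lmapDomain M A (↑),
    LinearMap.ext_on hspan fun x hx => ?_⟩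
  have hsupp : ((i x).support : Set ι) ⊆ J := Set.subset_biUnion_of_mem (u := fun x =>
    ((i x).support : Set ι)) hx
  have hmap : Finsupp.mapDomain (↑) (Finsupp.subtypeDomain (· ∈ J) (i x)) = i x := by
    refine (Finsupp.embDomain_eq_mapDomain (.subtype _) _).symm.trans ?_
    rw [← Finsupp.extendDomain_eq_embDomain_subtype, Finsupp.extendDomain_subtypeDomain _ hsupp]
  exact (congrArg p hmap).trans (LinearMap.congr_fun hpi x)

variable {P : Type u} {A : Type u} [Ring A] [AddCommGroup P] [Module A P]

theorem isCountablyGen_finsupp_self (A : Type u) [Ring A] (ι : Type*) [Countable ι] :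
    IsCountablyGen A (ι →₀ A) :=
  IsCountablyGen.of_finite.finsupp ι

theorem memAdd_self_iff_projective : MemAdd A A P ↔ Module.Projective A P := by
  constructor
  · rintro ⟨ι, i, p, h⟩
    exact Module.Projective.of_split i p h
  · intro h
    exact ⟨P, IsSummand.of_surjective (Finsupp.linearCombination_id_surjective A P)⟩

theorem memFinAdd_self_iff_finite [Module.Projective A P] :
    MemFinAdd A A P ↔ Module.Finite A P := by
  constructor
  · rintro ⟨n, h⟩
    exact h.finite
  · intro h
    obtain ⟨n, f, hf⟩ := Module.Finite.exists_fin' A P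
    exact ⟨n, IsSummand.of_surjective hf⟩

end RegularModule

section HomFunctor

-- The structures that `DomMulAct` transfers to `EndOp R M` agree with those underlying its ring
-- structure, but only after unfolding, so instance search needs these shortcuts.
instance endOpSemiring (R : Type v) [Ring R] (M : Type u) [AddCommGroup M] [Module R M] :
    Semiring (EndOp R M) := Ring.toSemiring

instance endOpNonAssocSemiring (R : Type v) [Ring R] (M : Type u) [AddCommGroup M] [Module R M] :
    NonAssocSemiring (EndOp R M) := Semiring.toNonAssocSemiring

instance endOpModule (R : Type v) [Ring R] (M : Type u) [AddCommGroup M] [Module R M] :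
    @Module (EndOp R M) (EndOp R M) Ring.toSemiring Ring.toAddCommGroup.toAddCommMonoid :=
  Semiring.toModule

variable {R : Type v} [Ring R] {M : Type u} [AddCommGroup M] [Module R M]
  {X Y Z : Type u} [AddCommGroup X] [Module R X] [AddCommGroup Y] [Module R Y]
  [AddCommGroup Z] [Module R Z]

/-- The functor `Hom_R(M, -)` on morphisms: composition with `h`, as a map of right modules over
`End_R(M)`. -/
def homMap (h : X →ₗ[R] Y) : (M →ₗ[R] X) →ₗ[EndOp R M] (M →ₗ[R] Y) where
  toFun g := h ∘ₗ g
  map_add' g g' := LinearMap.comp_add g g' h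
  map_smul' _ _ := rfl

theorem homMap_apply (h : X →ₗ[R] Y) (g : M →ₗ[R] X) : homMap h g = h ∘ₗ g := rfl

theorem homMap_id : homMap (M := M) (LinearMap.id : X →ₗ[R] X) = LinearMap.id := rfl

theorem homMap_comp (g : Y →ₗ[R] Z) (f : X →ₗ[R] Y) :
    homMap (M := M) (g ∘ₗ f) = homMap g ∘ₗ homMap f := rfl

theorem IsSummand.hom (h : IsSummand R X Y) :
    IsSummand (EndOp R M) (M →ₗ[R] X) (M →ₗ[R] Y) := by
  obtain ⟨i, p, h⟩ := h
  exact ⟨homMap i, homMap p, by rw [← homMap_comp, h, homMap_id]⟩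

theorem exists_eq_sum_smul_lsingle [Module.Finite R M] {ι : Type*} (g : M →ₗ[R] (ι →₀ M)) :
    ∃ s : Finset ι, g = ∑ j ∈ s,
      (DomMulAct.mk (Finsupp.lapply j ∘ₗ g : Module.End R M)) •
        (Finsupp.lsingle j : M →ₗ[R] (ι →₀ M)) := by
  classical
  obtain ⟨t, ht⟩ := Module.Finite.fg_top (R := R) (M := M)
  refine ⟨t.biUnion fun x => (g x).support, LinearMap.ext_on ht fun x hx => ?_⟩
  rw [LinearMap.sum_apply]
  conv_lhs => rw [← Finsupp.sum_single (g x)]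
  exact Finsupp.sum_of_support_subset _
    (Finset.subset_biUnion_of_mem (fun x => (g x).support) hx) _ fun i _ => Finsupp.single_zero i

/-- The canonical map from a free right module over `End_R(M)` to `Hom_R(M, ⨁ M)`, which is an
isomorphism when `M` is finitely generated. -/
noncomputable def finsuppHom (R : Type v) [Ring R] (M : Type u) [AddCommGroup M] [Module R M]
    (ι : Type*) : (ι →₀ EndOp R M) →ₗ[EndOp R M] (M →ₗ[R] (ι →₀ M)) :=
  Finsupp.linearCombination (EndOp R M) fun j => Finsupp.lsingle j

theorem finsuppHom_apply {ι : Type*} (c : ι →₀ EndOp R M) (x : M) (j : ι) :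
    finsuppHom R M ι c x j = DomMulAct.mk.symm (c j) x := by
  induction c using Finsupp.induction_linear with
  | zero => rw [map_zero]; rfl
  | add c d hc hd =>
    rw [map_add, LinearMap.add_apply, Finsupp.add_apply, hc, hd, Finsupp.add_apply]
    rfl
  | single k a =>
    classical
    rw [finsuppHom, Finsupp.linearCombination_single]
    change Finsupp.single k (DomMulAct.mk.symm a x) j = _
    rw [Finsupp.single_apply, Finsupp.single_apply]
    split_ifs <;> rfl

theorem MemAdd.homMap_injective (h : MemAdd R M X) :
    Function.Injective (homMap (M := M) : (X →ₗ[R] Y) → _) := by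
  intro f g hfg
  obtain ⟨ι, i, p, hip⟩ := h
  have hp : f ∘ₗ p = g ∘ₗ p := Finsupp.lhom_ext' fun j => by
    rw [LinearMap.comp_assoc, LinearMap.comp_assoc]
    exact LinearMap.congr_fun hfg (p ∘ₗ Finsupp.lsingle j)
  rw [← LinearMap.comp_id f, ← LinearMap.comp_id g, ← hip, ← LinearMap.comp_assoc, hp,
    LinearMap.comp_assoc]

variable [Module.Finite R M]

theorem finsuppHom_bijective (ι : Type*) : Function.Bijective (finsuppHom R M ι) := by
  constructor
  · refine (injective_iff_map_eq_zero _).2 fun c hc => Finsupp.ext fun j => ?_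
    refine DomMulAct.mk.symm.injective (LinearMap.ext fun x => ?_)
    rw [← finsuppHom_apply, hc]
    rfl
  · intro g
    obtain ⟨s, hs⟩ := exists_eq_sum_smul_lsingle g
    refine ⟨∑ j ∈ s, Finsupp.single j (DomMulAct.mk (Finsupp.lapply j ∘ₗ g)), ?_⟩
    rw [map_sum]
    conv_rhs => rw [hs]
    exact Finset.sum_congr rfl fun j _ => Finsupp.linearCombination_single _ _ _

/-- The isomorphism of a free right module over `End_R(M)` with `Hom_R(M, ⨁ M)`. -/
noncomputable def finsuppHomEquiv (R : Type v) [Ring R] (M : Type u) [AddCommGroup M] [Module R M]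
    [Module.Finite R M] (ι : Type*) :
    (ι →₀ EndOp R M) ≃ₗ[EndOp R M] (M →ₗ[R] (ι →₀ M)) :=
  LinearEquiv.ofBijective _ (finsuppHom_bijective ι)

namespace MemAdd

theorem hom (h : MemAdd R M X) : MemAdd (EndOp R M) (EndOp R M) (M →ₗ[R] X) := by
  obtain ⟨ι, h⟩ := h
  exact ⟨ι, h.hom.trans (IsSummand.of_equiv (finsuppHomEquiv R M ι).symm)⟩

theorem isCountablyGen_hom (h : MemAdd R M X) (hX : IsCountablyGen R X) :
    IsCountablyGen (EndOp R M) (M →ₗ[R] X) := by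
  obtain ⟨ι, _, h⟩ := h.exists_countable hX
  exact (h.hom.trans (IsSummand.of_equiv (finsuppHomEquiv R M ι).symm)).isCountablyGen
    (isCountablyGen_finsupp_self _ ι)

theorem exists_homMap_eq (h : MemAdd R M X) (F : (M →ₗ[R] X) →ₗ[EndOp R M] (M →ₗ[R] Y)) :
    ∃ f : X →ₗ[R] Y, homMap f = F := by
  obtain ⟨ι, i, p, hip⟩ := h
  let k : (ι →₀ M) →ₗ[R] Y := Finsupp.lsum ℕ fun j => F (p ∘ₗ Finsupp.lsingle j)
  have comp_lsingle (j : ι) : k ∘ₗ Finsupp.lsingle j = F (p ∘ₗ Finsupp.lsingle j) :=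
    LinearMap.ext fun x => Finsupp.lsum_single ℕ _ j x
  refine ⟨k ∘ₗ i, LinearMap.ext fun g => ?_⟩
  obtain ⟨t, ht⟩ := exists_eq_sum_smul_lsingle (i ∘ₗ g)
  calc homMap (k ∘ₗ i) g = homMap k (i ∘ₗ g) := rfl
    _ = F (homMap p (i ∘ₗ g)) := by
      rw [ht, map_sum, map_sum, map_sum]
      refine Finset.sum_congr rfl fun j _ => ?_
      rw [map_smul, map_smul, map_smul, homMap_apply, homMap_apply, comp_lsingle]
    _ = F g := by rw [homMap_apply, ← LinearMap.comp_assoc, hip, LinearMap.id_comp]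

theorem isSummand_hom_iff (hX : MemAdd R M X) (hY : MemAdd R M Y) :
    IsSummand (EndOp R M) (M →ₗ[R] X) (M →ₗ[R] Y) ↔ IsSummand R X Y := by
  refine ⟨?_, IsSummand.hom⟩
  rintro ⟨F, G, hFG⟩
  obtain ⟨f, rfl⟩ := hX.exists_homMap_eq F
  obtain ⟨g, rfl⟩ := hY.exists_homMap_eq G
  exact ⟨f, g, hX.homMap_injective hFG⟩

theorem nonempty_equiv_of_hom (hX : MemAdd R M X) (hY : MemAdd R M Y)
    (e : (M →ₗ[R] X) ≃ₗ[EndOp R M] (M →ₗ[R] Y)) : Nonempty (X ≃ₗ[R] Y) := by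
  obtain ⟨f, hf⟩ := hX.exists_homMap_eq e.toLinearMap
  obtain ⟨g, hg⟩ := hY.exists_homMap_eq e.symm.toLinearMap
  refine ⟨LinearEquiv.ofLinearMap f g (hY.homMap_injective (M := M) ?_)
    (hX.homMap_injective (M := M) ?_)⟩
  · rw [homMap_comp, hf, hg, homMap_id, e.comp_symm]
  · rw [homMap_comp, hf, hg, homMap_id, e.symm_comp]

theorem memFinAdd_hom_iff (hX : MemAdd R M X) :
    MemFinAdd (EndOp R M) (EndOp R M) (M →ₗ[R] X) ↔ MemFinAdd R M X := by
  refine exists_congr fun n => ?_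
  let e := (Finsupp.linearEquivFunOnFinite (EndOp R M) (EndOp R M) (Fin n)).symm.trans
    (finsuppHomEquiv R M (Fin n))
  let e' := Finsupp.linearEquivFunOnFinite R M (Fin n)
  rw [← hX.isSummand_hom_iff (MemFinAdd.memAdd ⟨n, IsSummand.of_equiv (LinearEquiv.refl _ _)⟩)]
  exact ⟨fun h => (h.trans (IsSummand.of_equiv e)).trans (IsSummand.of_equiv e').hom,
    fun h => (h.trans (IsSummand.of_equiv e'.symm).hom).trans (IsSummand.of_equiv e.symm)⟩

theorem exists_hom_equiv_of_isSummand (hY : MemAdd R M Y) {P : Type u} [AddCommGroup P]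
    [Module (EndOp R M) P] (hP : IsSummand (EndOp R M) P (M →ₗ[R] Y)) :
    ∃ X : ModuleCat.{u} R, IsSummand R X Y ∧ Nonempty ((M →ₗ[R] X) ≃ₗ[EndOp R M] P) := by
  obtain ⟨s, q, hqs⟩ := hP
  obtain ⟨e, he⟩ := hY.exists_homMap_eq (s ∘ₗ q)
  have hee : e ∘ₗ e = e := hY.homMap_injective (M := M) <| by
    rw [homMap_comp, he, LinearMap.comp_assoc, ← LinearMap.comp_assoc q, hqs, LinearMap.id_comp]
  let i := (LinearMap.range e).subtype
  let p := e.rangeRestrict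
  have hip : i ∘ₗ p = e := LinearMap.subtype_comp_codRestrict _ _ _
  have hpi : p ∘ₗ i = LinearMap.id := LinearMap.ext fun ⟨_, y, hy⟩ =>
    Subtype.ext (by subst hy; exact LinearMap.congr_fun hee y)
  have hsq : s ∘ₗ q = homMap (i ∘ₗ p) := by rw [hip, he]
  refine ⟨ModuleCat.of R (LinearMap.range e), ⟨i, p, hpi⟩,
    ⟨LinearEquiv.ofLinearMap (q ∘ₗ homMap i) (homMap p ∘ₗ s) ?_ ?_⟩⟩
  · calc (q ∘ₗ homMap i) ∘ₗ homMap p ∘ₗ s = q ∘ₗ homMap (i ∘ₗ p) ∘ₗ s := rfl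
      _ = (q ∘ₗ s) ∘ₗ q ∘ₗ s := by rw [hip, he]; rfl
      _ = LinearMap.id := by rw [hqs, LinearMap.id_comp]
  · calc (homMap p ∘ₗ s) ∘ₗ q ∘ₗ homMap i = homMap p ∘ₗ (s ∘ₗ q) ∘ₗ homMap i := rfl
      _ = homMap ((p ∘ₗ i) ∘ₗ p ∘ₗ i) := by rw [hsq]; rfl
      _ = LinearMap.id := by rw [hpi, LinearMap.id_comp, homMap_id]

end MemAdd

theorem exists_hom_equiv {P : Type u} [AddCommGroup P] [Module (EndOp R M) P]
    [Module.Projective (EndOp R M) P] (hP : IsCountablyGen (EndOp R M) P) :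
    ∃ X : ModuleCat.{u} R, IsCountablyGen R X ∧ MemAdd R M X ∧
      Nonempty ((M →ₗ[R] X) ≃ₗ[EndOp R M] P) := by
  obtain ⟨ι, _, h⟩ := MemAdd.exists_countable (memAdd_self_iff_projective.2 ‹_›) hP
  obtain ⟨X, hX, e⟩ := MemAdd.exists_hom_equiv_of_isSummand
    ⟨ι, IsSummand.of_equiv (LinearEquiv.refl _ _)⟩
    (h.trans (IsSummand.of_equiv (finsuppHomEquiv R M ι)))
  exact ⟨X, hX.isCountablyGen (IsCountablyGen.of_finite.finsupp ι), ⟨ι, hX⟩, e⟩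

end HomFunctor

section Classes

theorem mem_vMonoid_iff {A : Type v} [Ring A] {M N : Type u} [AddCommGroup M] [Module A M]
    [AddCommGroup N] [Module A N] : isoClass A N ∈ VMonoid A M ↔ MemFinAdd A M N := by
  refine ⟨?_, fun h => ⟨ModuleCat.of A N, rfl, h⟩⟩
  rintro ⟨L, hL, h⟩
  obtain ⟨e⟩ := isoClass_eq_iff.1 hL
  exact h.imp fun _ h => (IsSummand.of_equiv e.symm).trans h

theorem vMonoid_le_vStar {A : Type v} [Ring A] {M : Type u} [AddCommGroup M] [Module A M]
    [Module.Finite A M] : VMonoid.{u, v} A M ≤ VStar A M := by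
  rintro _ ⟨N, rfl, hN⟩
  exact ⟨N, rfl, hN.isCountablyGen, hN.memAdd⟩

variable {A : Type u} [Ring A] {P Q : Type u} [AddCommGroup P] [Module A P]
  [AddCommGroup Q] [Module A Q]

theorem IsBig.of_equiv {I : Ideal A} (e : P ≃ₗ[A] Q) (h : IsBig I Q) : IsBig I P :=
  fun L hL hLproj hIL => by
    obtain ⟨f, hf⟩ := h L hL hLproj hIL
    exact ⟨f ∘ₗ e.toLinearMap, hf.comp e.surjective⟩

theorem isoClass_quotient_congr {I : Ideal A} [I.IsTwoSided] (e : P ≃ₗ[A] Q) :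
    isoClass (A ⧸ I) (P ⧸ I • (⊤ : Submodule A P)) =
      isoClass (A ⧸ I) (Q ⧸ I • (⊤ : Submodule A Q)) := by
  have hmap : (I • (⊤ : Submodule A P)).map e.toLinearMap = I • ⊤ := by
    rw [Submodule.map_smul'', Submodule.map_top, LinearEquiv.range]
  exact isoClass_eq_iff.2 ⟨(Submodule.Quotient.equiv _ _ e hmap).restrictScalars (A ⧸ I)⟩

theorem iotaRel_iff [Module.Projective A P] (hP : IsCountablyGen A P) {I : TraceIdeals A}
    {q : IsoClass.{u, u} (A ⧸ I.ideal)} :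
    IotaRel I q (isoClass A P) ↔
      IsBig I.ideal P ∧ isoClass (A ⧸ I.ideal) (P ⧸ I.ideal • (⊤ : Submodule A P)) = q := by
  constructor
  · rintro ⟨Q, hQ, -, -, hbig, hq⟩
    obtain ⟨e⟩ := isoClass_eq_iff.1 hQ
    exact ⟨hbig.of_equiv e.symm, (isoClass_quotient_congr e.symm).trans hq⟩
  · rintro ⟨hbig, hq⟩
    exact ⟨ModuleCat.of A P, rfl, hP, ‹_›, hbig, hq⟩

namespace IotaRel

variable {I J : TraceIdeals A} {q q₁ q₂ : IsoClass.{u, u} (A ⧸ I.ideal)}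
  {q' : IsoClass.{u, u} (A ⧸ J.ideal)} {p p₁ p₂ : IsoClass.{u, u} A}

theorem mem_vStar (h : IotaRel I q p) : p ∈ VStar A A := by
  obtain ⟨P, rfl, hP, hPproj, -⟩ := h
  exact ⟨P, rfl, hP, memAdd_self_iff_projective.2 hPproj⟩

theorem ideal_le (h : IotaRel I q p) (hq' : q' ∈ VMonoid (A ⧸ J.ideal) (A ⧸ J.ideal))
    (h' : IotaRel J q' p) : I.ideal ≤ J.ideal := by
  obtain ⟨P, rfl, hP, hPproj, -, rfl⟩ := h'
  obtain ⟨X, hX, hXJ⟩ := memFinAdd_quotient_iff.1 (mem_vMonoid_iff.1 hq')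
  have hbig := ((iotaRel_iff hP).1 h).1
  obtain ⟨_, W, hW, hWproj, rfl⟩ := I
  exact hbig.traceOf_le hW hX hXJ

theorem eq_left (h₁ : IotaRel I q₁ p) (h₂ : IotaRel I q₂ p) : q₁ = q₂ := by
  obtain ⟨P, rfl, hP, hPproj, -, rfl⟩ := h₁
  exact ((iotaRel_iff hP).1 h₂).2

theorem eq_right [IsNoetherianRing A] (h₁ : IotaRel I q p₁) (h₂ : IotaRel I q p₂) : p₁ = p₂ := by
  obtain ⟨P₁, rfl, hP₁, hproj₁, hbig₁, rfl⟩ := h₁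
  obtain ⟨P₂, rfl, hP₂, hproj₂, hbig₂, hq⟩ := h₂
  obtain ⟨e⟩ := isoClass_eq_iff.1 hq
  replace e := e.symm.restrictScalars A
  obtain ⟨_, W, hW, hWproj, rfl⟩ := I
  exact isoClass_eq_iff.2 (hbig₁.nonempty_equiv hW hP₁ hP₂ hbig₂ e)

theorem mem_vMonoid_iff (hq : q ∈ VMonoid (A ⧸ I.ideal) (A ⧸ I.ideal)) (h : IotaRel I q p) :
    p ∈ VMonoid A A ↔ I.ideal = ⊥ := by
  obtain ⟨P, rfl, -, hPproj, hbig, rfl⟩ := h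
  rw [_root_.mem_vMonoid_iff, memFinAdd_self_iff_finite]
  constructor
  · intro hfin
    obtain ⟨_, W, hW, hWproj, rfl⟩ := I
    exact le_bot_iff.1 (hbig.traceOf_le hW hfin.fg_top (top_sup_eq _))
  · intro hI
    obtain ⟨X, hX, hXI⟩ := memFinAdd_quotient_iff.1 (_root_.mem_vMonoid_iff.1 hq)
    rw [hI, Submodule.bot_smul, sup_bot_eq] at hXI
    exact ⟨hXI ▸ hX⟩

end IotaRel

theorem existsUnique_iotaRel (R : Type v) [CommRing R] [IsNoetherianRing R] [Algebra R A]
    [Module.Finite R A] {p : IsoClass.{u, u} A} (hp : p ∈ VStar A A) :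
    ∃! d : (Σ I : TraceIdeals A, VMonoid (A ⧸ I.ideal) (A ⧸ I.ideal)),
      IotaRel d.1 (d.2 : IsoClass.{u, u} (A ⧸ d.1.ideal)) p := by
  obtain ⟨P, rfl, hP, hadd⟩ := hp
  have := memAdd_self_iff_projective.1 hadd
  obtain ⟨I, hbig, hfg⟩ := exists_isBig R hP
  have h := (iotaRel_iff hP).2 ⟨hbig, rfl⟩
  have hq := mem_vMonoid_iff.2 (memFinAdd_quotient_iff.2 hfg)
  refine ⟨⟨I, _, hq⟩, h, ?_⟩
  rintro ⟨J, q', hq'⟩ h'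
  obtain rfl : J = I := Subtype.ext (le_antisymm (h'.ideal_le hq h) (h.ideal_le hq' h'))
  obtain rfl : q' = _ := h'.eq_left h
  rfl

theorem existsUnique_iotaRel_right (R : Type v) [CommRing R] [IsNoetherianRing R] [Algebra R A]
    [Module.Finite R A] (I : TraceIdeals A)
    (q : VMonoid.{u, u} (A ⧸ I.ideal) (A ⧸ I.ideal)) :
    ∃! p : IsoClass.{u, u} A, IotaRel I (q : IsoClass.{u, u} (A ⧸ I.ideal)) p := by
  have : IsNoetherianRing A := IsNoetherianRing.of_finite R A
  obtain ⟨_, N, rfl, hN⟩ := q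
  obtain ⟨P, hP, hPproj, hbig, ⟨e⟩⟩ := exists_isBig_quotient_equiv R I hN
  have h := (iotaRel_iff hP).2 ⟨hbig, isoClass_eq_iff.2 ⟨e⟩⟩
  exact ⟨isoClass A P, h, fun p' h' => h'.eq_right h⟩

end Classes

section HomClass

variable {R : Type v} [Ring R] {M : Type u} [AddCommGroup M] [Module R M] [Module.Finite R M]

theorem homClass_bijOn :
    Set.BijOn (homClass R M) (VStar R M) (VStar.{u, u} (EndOp R M) (EndOp R M)) := by
  refine ⟨?_, ?_, ?_⟩
  · rintro _ ⟨X, rfl, hX, hadd⟩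
    exact ⟨ModuleCat.of _ (M →ₗ[R] X), rfl, hadd.isCountablyGen_hom hX, hadd.hom⟩
  · rintro _ ⟨X, rfl, -, hX⟩ _ ⟨Y, rfl, -, hY⟩ h
    obtain ⟨e⟩ := isoClass_eq_iff.1 h
    exact isoClass_eq_iff.2 (hX.nonempty_equiv_of_hom hY e)
  · rintro _ ⟨P, rfl, hP, hadd⟩
    have := memAdd_self_iff_projective.1 hadd
    obtain ⟨X, hX, hXadd, e⟩ := exists_hom_equiv hP
    exact ⟨isoClass R X, ⟨X, rfl, hX, hXadd⟩, isoClass_eq_iff.2 e⟩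

theorem homClass_mem_vMonoid_iff {x : IsoClass.{u, v} R} (hx : x ∈ VStar R M) :
    homClass R M x ∈ VMonoid (EndOp R M) (EndOp R M) ↔ x ∈ VMonoid R M := by
  obtain ⟨X, rfl, -, hadd⟩ := hx
  rw [mem_vMonoid_iff, ← hadd.memFinAdd_hom_iff]
  exact mem_vMonoid_iff

theorem AlphaRel.mem_vMonoid_iff {I : TraceIdeals (EndOp R M)}
    {q : IsoClass.{u, u} (EndOp R M ⧸ I.ideal)} {x : IsoClass.{u, v} R} (hq : q ∈ VQuot R M I)
    (h : AlphaRel I q x) : x ∈ VMonoid R M ↔ I.ideal = ⊥ :=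
  (homClass_mem_vMonoid_iff h.1).symm.trans (h.2.mem_vMonoid_iff hq)

end HomClass

section Endomorphisms

variable {R : Type v} [CommRing R] {M : Type u} [AddCommGroup M] [Module R M]

instance endOpAlgebra : Algebra R (EndOp R M) :=
  RingHom.toAlgebra'
    { toFun := fun r => DomMulAct.mk (algebraMap R (Module.End R M) r)
      map_one' := congrArg DomMulAct.mk (map_one _)
      map_mul' := fun r s => congrArg DomMulAct.mk
        ((map_mul (algebraMap R (Module.End R M)) r s).trans (Algebra.commutes r _))
      map_zero' := congrArg DomMulAct.mk (map_zero _)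
      map_add' := fun r s => congrArg DomMulAct.mk (map_add _ r s) }
    fun r a => congrArg DomMulAct.mk (Algebra.commutes r (DomMulAct.mk.symm a)).symm

instance endOp_finite [IsNoetherianRing R] [Module.Finite R M] : Module.Finite R (EndOp R M) := by
  let f : Module.End R M →ₗ[R] EndOp R M :=
    { toFun := DomMulAct.mk
      map_add' := fun _ _ => rfl
      map_smul' := fun r a => by
        rw [RingHom.id_apply, Algebra.smul_def, Algebra.commutes, Algebra.smul_def]
        rfl }
  exact Module.Finite.of_surjective f DomMulAct.mk.surjective

end Endomorphisms

theorem mainTheorem5_general {R : Type v} [Ring R] (M : Type u) [AddCommGroup M] [Module R M]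
    [Module.Finite R M] (C : Type*) [CommRing C] [IsNoetherianRing C] [Algebra C (EndOp R M)]
    [Module.Finite C (EndOp R M)] :
    ((VStar R M : Set (IsoClass.{u, v} R)) = (VMonoid R M : Set (IsoClass.{u, v} R)) ∪ BSet R M ∧
      Disjoint (VMonoid R M : Set (IsoClass.{u, v} R)) (BSet R M)) ∧
    (∀ x ∈ VStar R M, ∃! d : (Σ I : TraceIdeals (EndOp R M), VQuot R M I),
      AlphaRel d.1 (d.2 : IsoClass.{u, u} (EndOp R M ⧸ d.1.ideal)) x) ∧
    (∀ (I : TraceIdeals (EndOp R M)) (q : VQuot R M I),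
      ∃! x : IsoClass.{u, v} R, AlphaRel I (q : IsoClass.{u, u} (EndOp R M ⧸ I.ideal)) x) := by
  have existsUnique_pair (x) (hx : x ∈ VStar R M) :
      ∃! d : (Σ I : TraceIdeals (EndOp R M), VQuot R M I), AlphaRel d.1 d.2.1 x := by
    simpa only [AlphaRel, hx, true_and] using existsUnique_iotaRel C (homClass_bijOn.mapsTo hx)
  refine ⟨⟨Set.Subset.antisymm (fun x hx => ?_) (Set.union_subset vMonoid_le_vStar ?_), ?_⟩,
    existsUnique_pair, fun I q => ?_⟩
  · obtain ⟨⟨I, q, hq⟩, h, -⟩ := existsUnique_pair x hx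
    exact or_iff_not_imp_left.2 fun hxM => ⟨I, mt (h.mem_vMonoid_iff hq).2 hxM, q, hq, h⟩
  · rintro x ⟨I, -, q, -, h⟩
    exact h.1
  · refine Set.disjoint_left.2 ?_
    rintro x hxM ⟨I, hI, q, hq, h⟩
    exact hI ((h.mem_vMonoid_iff hq).1 hxM)
  · obtain ⟨p, hp, hunique⟩ := existsUnique_iotaRel_right C I q
    obtain ⟨x, hx, rfl⟩ := homClass_bijOn.surjOn hp.mem_vStar
    exact ⟨x, ⟨hx, hp⟩, fun y hy => homClass_bijOn.injOn hy.1 hx (hunique _ hy.2)⟩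

theorem mainTheorem5 {R : Type v} [CommRing R] [IsNoetherianRing R]
    (M : Type u) [AddCommGroup M] [Module R M] [Module.Finite R M] :
    -- `V*(M)` is the disjoint union of `V(M)` and `B(M)`
    ((VStar R M : Set (IsoClass.{u, v} R)) = (VMonoid R M : Set (IsoClass.{u, v} R)) ∪ BSet R M ∧
      Disjoint (VMonoid R M : Set (IsoClass.{u, v} R)) (BSet R M)) ∧
    -- every class in `V*(M)` is `α_I(q)` for exactly one trace ideal `I` and one `q` in `V(S/I)`
    (∀ x ∈ VStar R M, ∃! d : (Σ I : TraceIdeals (EndOp R M), VQuot R M I),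
      AlphaRel d.1 (d.2 : IsoClass.{u, u} (EndOp R M ⧸ d.1.ideal)) x) ∧
    -- every such pair `(I, q)` determines exactly one class `α_I(q)` in `V*(M)`
    (∀ (I : TraceIdeals (EndOp R M)) (q : VQuot R M I),
      ∃! x : IsoClass.{u, v} R, AlphaRel I (q : IsoClass.{u, u} (EndOp R M ⧸ I.ideal)) x) :=
  mainTheorem5_general M R
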